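/- Let $K$ be a field and let $l,m,n$ be positive integers such that $2\le m\le n$, $l\mid n$ and $l\le\min\{m-1,\tfrac n2\}$. Let $R=K[x_1,\dots,x_n]$ with the standard grading, where indices of variables are read modulo $n$. Put $k=\frac nl$ and let $$I_{m,l}(C_n)=(u_1,\dots,u_k)\subseteq R,\qquad u_i=\prod_{j=1}^{m}x_{(i-1)l+j}\quad(1\le i\le k),$$ be the path ideal of the $n$-cycle $C_n$. Write $m=tl+s$ with $0\le s<l$ and assume $t\ge 2$. Write $k=p(t+1)+d$ with $p\ge 0$ and $0\le d\le t$. For $i\ge 0$ let $\beta_{i,n}(R/I_{m,l}(C_n))$ be the graded Betti number in homological degree $i$ and internal degree $n$, that is, the multiplicity of $R(-n)$ in the $i$-th free module of a minimal graded free resolution of $R/I_{m,l}(C_n)$ (such a resolution exists, and this number does not depend on its choice). Then $$\beta_{i,n}\bigl(R/I_{m,l}(C_n)\bigr)=\begin{cases}t,&\text{if } d=0 \text{ and } i=2p;\\ 1,&\text{if } d\neq 0 \text{ and } i=2p+1;\\ 0,&\text{otherwise.}\end{cases}$$ -/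

import Mathlib

open MvPolynomial

/-- The degree-`j` component of the graded free module `⨁ₐ R(-deg a)` over the standard graded
polynomial ring `R = K[x_s : s ∈ σ]`, whose elements are written as vectors `v : ι → R`. The basis
vector `e_a` has degree `deg a`, so a term `c • x^e • e_a` has degree `|e| + deg a`; the component
consists of the vectors all of whose terms have degree `j`. -/
def gradedFreePiece {σ K ι : Type*} [Field K] (deg : ι → ℕ) (j : ℕ) :
    Set (ι → MvPolynomial σ K) :=
  {v | ∀ a, ∀ e ∈ (v a).support, e.degree + deg a = j}

/-- A minimal graded free resolution
`⋯ → F₂ → F₁ → F₀ → R ⧸ I → 0` of `R ⧸ I`, where `R = K[x_s : s ∈ σ]` is standard graded,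
`F_i = ⨁ₐ R(-deg i a)` is graded free of finite rank, all maps are graded of degree `0`, the
sequence is exact, and the image of every differential lies in `𝔪 F_i`, where `𝔪` is the ideal
generated by the variables. -/
structure MinimalGradedFreeResolution {σ K : Type*} [Field K] (I : Ideal (MvPolynomial σ K)) where
  /-- the rank of `F_i` -/
  rank : ℕ → ℕ
  /-- the degrees of the basis elements of `F_i` -/
  deg : ∀ i, Fin (rank i) → ℕ
  /-- the differential `F_{i+1} → F_i` -/
  d : ∀ i, (Fin (rank (i + 1)) → MvPolynomial σ K) →ₗ[MvPolynomial σ K]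
    (Fin (rank i) → MvPolynomial σ K)
  /-- the augmentation `F₀ → R ⧸ I` -/
  aug : (Fin (rank 0) → MvPolynomial σ K) →ₗ[MvPolynomial σ K] (MvPolynomial σ K ⧸ I)
  d_graded : ∀ i j, ∀ v ∈ gradedFreePiece (deg (i + 1)) j, d i v ∈ gradedFreePiece (deg i) j
  /-- The degree-`j` component of `R ⧸ I` is the image of that of `R`. -/
  aug_graded : ∀ j, ∀ v ∈ gradedFreePiece (deg 0) j,
    ∃ f : MvPolynomial σ K, f.IsHomogeneous j ∧ aug v = Ideal.Quotient.mk I f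
  aug_surjective : Function.Surjective aug
  exact_zero : Function.Exact (d 0) aug
  exact_succ : ∀ i, Function.Exact (d (i + 1)) (d i)
  minimal : ∀ i v a, d i v a ∈ Ideal.span (Set.range (X : σ → MvPolynomial σ K))

/-- The multiplicity of `R(-j)` in the `i`-th module `F_i` of a minimal graded free resolution of
`R ⧸ I`, that is, the graded Betti number `β_{i,j}(R ⧸ I)` as read off from this resolution. -/
def MinimalGradedFreeResolution.betti {σ K : Type*} [Field K] {I : Ideal (MvPolynomial σ K)}
    (F : MinimalGradedFreeResolution I) (i j : ℕ) : ℕ :=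
  (Finset.univ.filter fun a : Fin (F.rank i) => F.deg i a = j).card

/-- The path ideal `I_{m,l}(C_n)` of the `n`-cycle in `K[x_1, …, x_n]`, generated by the monomials
`∏_{j=1}^m x_{(i-1)l+j}` for `1 ≤ i ≤ n / gcd(l, n)`, where the indices of the variables are taken
modulo `n`. -/
noncomputable def cyclePathIdeal (K : Type*) [Field K] (m l n : ℕ) : Ideal (MvPolynomial (ZMod n) K) :=
  Ideal.span {u | ∃ i ∈ Finset.Icc 1 (n / Nat.gcd l n),
    u = ∏ j ∈ Finset.Icc 1 m, X (((i - 1) * l + j : ℕ) : ZMod n)}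

/-!
Modulo the variables the differential of a minimal resolution vanishes, so its graded Betti numbers
in degree `n` are the dimensions of the degree-`n` homology, modulo the variables, of any graded
free resolution. For an ideal generated by `k` monomials we use the Taylor resolution: in degree `n`
its basis elements are the sets of generators whose least common multiple has degree `n`, which for
the path ideal are the sets `S` of starting points in `{0, …, k - 1}` whose cyclic intervals of
length `t` cover the cycle. With the last element `e` of `S` fixed, call the numbers congruent to
`0` or to `e - k` modulo `t + 1` nodes. If `S` contains an element that is not a node, adding or
deleting the last node before the first such element again gives a cover, and this is an acyclic
matching. The unmatched covers are those that consist of nodes; `e` determines them, and they all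
have `2p` elements if `d = 0` and `2p + 1` elements otherwise. So the homology is concentrated in
one homological degree, and its dimension is the number of unmatched covers, which is `t` or `1`.
-/

attribute [local instance] MvPolynomial.gradedAlgebra

/-! ### Graded free modules -/

namespace GradedFree

/-- Linear maps between the free modules with bases `ι` and `κ` over a polynomial ring. -/
abbrev FreeMap (σ K ι κ : Type*) [CommSemiring K] :=
  (ι → MvPolynomial σ K) →ₗ[MvPolynomial σ K] (κ → MvPolynomial σ K)

section Pieces

variable {σ K ι κ μ : Type*} [Field K] {deg : ι → ℕ} {deg' : κ → ℕ} {deg'' : μ → ℕ}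

theorem mem_gradedFreePiece {j : ℕ} {v : ι → MvPolynomial σ K} :
    v ∈ gradedFreePiece deg j ↔ ∀ a e, coeff e (v a) ≠ 0 → e.degree + deg a = j := by
  simp [gradedFreePiece, mem_support_iff]

/-- The degree-`j` component of a graded free module, as a `K`-subspace. -/
def piece (deg : ι → ℕ) (j : ℕ) : Submodule K (ι → MvPolynomial σ K) where
  carrier := gradedFreePiece deg j
  add_mem' {v w} hv hw := mem_gradedFreePiece.2 fun a e h => by
    by_cases hva : coeff e (v a) = 0
    · exact mem_gradedFreePiece.1 hw a e fun hwa => h (by simp [hva, hwa])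
    · exact mem_gradedFreePiece.1 hv a e hva
  zero_mem' := mem_gradedFreePiece.2 (by simp)
  smul_mem' c v hv := mem_gradedFreePiece.2 fun a e h =>
    mem_gradedFreePiece.1 hv a e fun hva => h (by simp [hva])

theorem mem_piece {j : ℕ} {v : ι → MvPolynomial σ K} :
    v ∈ piece deg j ↔ v ∈ gradedFreePiece deg j := Iff.rfl

theorem smul_mem_gradedFreePiece {i j : ℕ} {p : MvPolynomial σ K} {v : ι → MvPolynomial σ K}
    (hp : ∀ e, coeff e p ≠ 0 → e.degree + i = j) (hv : v ∈ gradedFreePiece deg i) :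
    p • v ∈ gradedFreePiece deg j := by
  classical
  refine mem_gradedFreePiece.2 fun a e h => ?_
  rw [Pi.smul_apply, smul_eq_mul, coeff_mul] at h
  obtain ⟨⟨x, y⟩, hxy, hne⟩ := Finset.exists_ne_zero_of_sum_ne_zero h
  have hx := hp x (left_ne_zero_of_mul hne)
  have hy := mem_gradedFreePiece.1 hv a y (right_ne_zero_of_mul hne)
  obtain rfl : x + y = e := Finset.HasAntidiagonal.mem_antidiagonal.1 hxy
  rw [map_add]
  omega

/-- The projection of a graded free module to its component of degree `j`. -/
noncomputable def component (deg : ι → ℕ) (j : ℕ) :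
    (ι → MvPolynomial σ K) →ₗ[K] (ι → MvPolynomial σ K) :=
  LinearMap.pi fun a =>
    if deg a ≤ j then homogeneousComponent (j - deg a) ∘ₗ LinearMap.proj a else 0

theorem coeff_component (deg : ι → ℕ) (j : ℕ) (v : ι → MvPolynomial σ K) (a : ι) (e : σ →₀ ℕ) :
    coeff e (component deg j v a) = if e.degree + deg a = j then coeff e (v a) else 0 := by
  rw [component, LinearMap.pi_apply]
  by_cases h : deg a ≤ j
  · simp only [h, if_true, LinearMap.comp_apply, LinearMap.proj_apply, coeff_homogeneousComponent]
    exact if_congr (by omega) rfl rfl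
  · simp [h, show ¬ e.degree + deg a = j by omega]

theorem component_mem (deg : ι → ℕ) (j : ℕ) (v : ι → MvPolynomial σ K) :
    component deg j v ∈ gradedFreePiece deg j :=
  mem_gradedFreePiece.2 fun a e h => by
    contrapose! h
    rw [coeff_component, if_neg h]

theorem component_eq_self {j : ℕ} {v : ι → MvPolynomial σ K} (hv : v ∈ gradedFreePiece deg j) :
    component deg j v = v := by
  ext a e
  rw [coeff_component, ite_eq_left_iff]
  contrapose!
  exact fun h => mem_gradedFreePiece.1 hv a e h.symm

theorem component_eq_zero {i j : ℕ} (hij : i ≠ j) {v : ι → MvPolynomial σ K}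
    (hv : v ∈ gradedFreePiece deg i) : component deg j v = 0 := by
  ext a e
  rw [coeff_component, Pi.zero_apply, coeff_zero, ite_eq_right_iff]
  rintro rfl
  contrapose! hij
  exact (mem_gradedFreePiece.1 hv a e hij).symm

theorem single_monomial_mem [DecidableEq ι] (deg : ι → ℕ) (a : ι) (e : σ →₀ ℕ) (c : K) :
    Pi.single a (monomial e c) ∈ gradedFreePiece deg (e.degree + deg a) := by
  classical
  refine mem_gradedFreePiece.2 fun b e' h => ?_
  obtain rfl | hb := eq_or_ne b a
  · rw [Pi.single_eq_same, coeff_monomial] at h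
    rw [(ite_ne_right_iff.1 h).1]
  · simp [Pi.single_eq_of_ne hb] at h

theorem single_one_mem [DecidableEq ι] (deg : ι → ℕ) (a : ι) :
    Pi.single a (1 : MvPolynomial σ K) ∈ gradedFreePiece deg (deg a) := by
  simpa using single_monomial_mem deg a (0 : σ →₀ ℕ) (1 : K)

theorem piece_induction [Finite ι] (deg : ι → ℕ) {P : (ι → MvPolynomial σ K) → Prop}
    (zero : P 0) (add : ∀ v w, P v → P w → P (v + w))
    (homogeneous : ∀ j, ∀ v ∈ gradedFreePiece deg j, P v) (v : ι → MvPolynomial σ K) : P v := by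
  classical
  have := Fintype.ofFinite ι
  have single (a : ι) (p : MvPolynomial σ K) : P (Pi.single a p) := by
    induction p using MvPolynomial.induction_on' with
    | monomial e c => exact homogeneous _ _ (single_monomial_mem deg a e c)
    | add p q hp hq => rw [Pi.single_add]; exact add _ _ hp hq
  rw [← Finset.univ_sum_single v]
  exact Finset.sum_induction _ P add zero fun a _ => single a _

theorem eventually_sum_component_eq [Finite ι] (deg : ι → ℕ) (v : ι → MvPolynomial σ K) :
    ∀ᶠ n in Filter.atTop, ∑ j ∈ Finset.range n, component deg j v = v := by
  induction v using piece_induction deg with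
  | zero => simp
  | add v w hv hw =>
    filter_upwards [hv, hw] with n hnv hnw
    simp only [map_add, Finset.sum_add_distrib, hnv, hnw]
  | homogeneous i v hv =>
    filter_upwards [Filter.eventually_gt_atTop i] with n hn
    rw [Finset.sum_eq_single_of_mem i (Finset.mem_range.2 hn) fun j _ hj =>
      component_eq_zero hj.symm hv, component_eq_self hv]

/-- A map between graded free modules is graded if it preserves degrees. -/
def IsGraded (deg : ι → ℕ) (deg' : κ → ℕ) (f : FreeMap σ K ι κ) : Prop :=
  ∀ j, ∀ v ∈ gradedFreePiece deg j, f v ∈ gradedFreePiece deg' j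

variable {f : FreeMap σ K ι κ} {g : FreeMap σ K κ μ}

theorem IsGraded.id : IsGraded deg deg (LinearMap.id : FreeMap σ K ι ι) := fun _ _ hv => hv

theorem IsGraded.comp (hg : IsGraded deg' deg'' g) (hf : IsGraded deg deg' f) :
    IsGraded deg deg'' (g ∘ₗ f) := fun j v hv => hg j _ (hf j v hv)

theorem IsGraded.map_component [Finite ι] (hf : IsGraded deg deg' f) (j : ℕ)
    (v : ι → MvPolynomial σ K) : f (component deg j v) = component deg' j (f v) := by
  induction v using piece_induction deg with
  | zero => simp only [map_zero]
  | add v w hv hw => simp only [map_add, hv, hw]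
  | homogeneous i v hv =>
    obtain rfl | h := eq_or_ne i j
    · rw [component_eq_self hv, component_eq_self (hf _ _ hv)]
    · rw [component_eq_zero h hv, component_eq_zero h (hf _ _ hv), map_zero]

theorem eq_sum_smul_single [Fintype ι] [DecidableEq ι] (v : ι → MvPolynomial σ K) :
    v = ∑ a, v a • Pi.single a (1 : MvPolynomial σ K) := by
  funext b
  simp [Finset.sum_apply, Pi.single_apply]

theorem isGraded_of_basis [Finite ι] [DecidableEq ι]
    (h : ∀ a, f (Pi.single a 1) ∈ gradedFreePiece deg' (deg a)) : IsGraded deg deg' f := by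
  intro j v hv
  have := Fintype.ofFinite ι
  rw [eq_sum_smul_single v, map_sum]
  refine mem_piece.1 (Submodule.sum_mem _ fun a _ => ?_)
  rw [map_smul]
  exact smul_mem_gradedFreePiece (mem_gradedFreePiece.1 hv a) (h a)

section Lifts

variable {N P : Type*} [AddCommGroup N] [Module (MvPolynomial σ K) N]
  [AddCommGroup P] [Module (MvPolynomial σ K) P] [Finite ι]

theorem ext_basis [DecidableEq ι] {f g : (ι → MvPolynomial σ K) →ₗ[MvPolynomial σ K] N}
    (h : ∀ a, f (Pi.single a 1) = g (Pi.single a 1)) : f = g :=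
  (Pi.basisFun _ ι).ext fun a => by rw [Pi.basisFun_apply, h]

theorem exists_map_single_eq [DecidableEq ι] (w : ι → P) :
    ∃ u : (ι → MvPolynomial σ K) →ₗ[MvPolynomial σ K] P, ∀ a, u (Pi.single a 1) = w a :=
  ⟨(Pi.basisFun _ ι).constr (MvPolynomial σ K) w, fun a => by
    rw [← Pi.basisFun_apply, Module.Basis.constr_basis]⟩

theorem exists_lift (f : (ι → MvPolynomial σ K) →ₗ[MvPolynomial σ K] N)
    (g : P →ₗ[MvPolynomial σ K] N) (h : ∀ v, f v ∈ LinearMap.range g) :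
    ∃ u : (ι → MvPolynomial σ K) →ₗ[MvPolynomial σ K] P, g ∘ₗ u = f := by
  classical
  choose w hw using h
  obtain ⟨u, hu⟩ := exists_map_single_eq (σ := σ) (K := K) fun a : ι => w (Pi.single a 1)
  exact ⟨u, ext_basis fun a => by rw [LinearMap.comp_apply, hu, hw]⟩

theorem exists_isGraded_lift [DecidableEq ι]
    (f : (ι → MvPolynomial σ K) →ₗ[MvPolynomial σ K] N)
    (g : (κ → MvPolynomial σ K) →ₗ[MvPolynomial σ K] N)
    (h : ∀ a, ∃ w ∈ gradedFreePiece deg' (deg a), g w = f (Pi.single a 1)) :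
    ∃ u : FreeMap σ K ι κ, IsGraded deg deg' u ∧ g ∘ₗ u = f := by
  choose w hw hgw using h
  obtain ⟨u, hu⟩ := exists_map_single_eq (σ := σ) (K := K) w
  exact ⟨u, isGraded_of_basis fun a => by rw [hu]; exact hw a,
    ext_basis fun a => by rw [LinearMap.comp_apply, hu, hgw]⟩

theorem IsGraded.exists_lift [Finite κ] {f : FreeMap σ K ι μ} (hf : IsGraded deg deg'' f)
    (hg : IsGraded deg' deg'' g) (h : ∀ v, f v ∈ LinearMap.range g) :
    ∃ u : FreeMap σ K ι κ, IsGraded deg deg' u ∧ g ∘ₗ u = f := by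
  classical
  refine exists_isGraded_lift f g fun a => ?_
  obtain ⟨w, hw⟩ := h (Pi.single a 1)
  refine ⟨component deg' (deg a) w, component_mem _ _ _, ?_⟩
  rw [hg.map_component, hw, component_eq_self (hf _ _ (single_one_mem deg a))]

end Lifts

end Pieces

section Reduction

variable {σ K ι κ μ : Type*} [Field K] [DecidableEq ι]
  {deg : ι → ℕ} {deg' : κ → ℕ} {deg'' : μ → ℕ} {n : ℕ}

/-- The map induced by `f` in degree `n` modulo the ideal generated by the variables: its matrix
consists of the constant terms of the entries of `f` between basis elements of degree `n`. -/
noncomputable def red [Fintype ι] (deg : ι → ℕ) (deg' : κ → ℕ) (n : ℕ) :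
    FreeMap σ K ι κ →+ (({a // deg a = n} → K) →ₗ[K] ({b // deg' b = n} → K)) where
  toFun f := Matrix.mulVecLin (Matrix.of fun b a => constantCoeff (f (Pi.single a.1 1) b.1))
  map_zero' := by
    ext a b
    simp
  map_add' f g := by
    ext a b
    simp

theorem red_apply [Fintype ι] (f : FreeMap σ K ι κ) (v : {a // deg a = n} → K)
    (b : {b // deg' b = n}) :
    red deg deg' n f v b = ∑ a, constantCoeff (f (Pi.single a.1 1) b.1) * v a := rfl

theorem red_single [Fintype ι] (f : FreeMap σ K ι κ) (a : {a // deg a = n})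
    (b : {b // deg' b = n}) :
    red deg deg' n f (Pi.single a 1) b = constantCoeff (f (Pi.single a.1 1) b.1) := by
  simp [red_apply, Pi.single_apply]

theorem red_id [Fintype ι] : red deg deg n (LinearMap.id : FreeMap σ K ι ι) = LinearMap.id := by
  refine LinearMap.ext fun v => funext fun b => ?_
  simp [red_apply, Pi.single_apply, Subtype.coe_inj]

variable {f : FreeMap σ K ι κ} {g : FreeMap σ K κ μ}

theorem constantCoeff_eq_zero {a : ι} {b : κ} (hf : IsGraded deg deg' f) (hab : deg' b ≠ deg a) :
    constantCoeff (f (Pi.single a 1) b) = 0 := by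
  contrapose! hab
  simpa using mem_gradedFreePiece.1 (hf _ _ (single_one_mem deg a)) b 0 hab

variable [Fintype ι] [Fintype κ] [DecidableEq κ]

/-- The constant term of a composite involves only intermediate basis elements of degree `n` as
soon as the entries of one factor vanish outside them. -/
theorem red_comp (h : ∀ (a : ι) (b : κ) (c : μ), deg a = n → deg'' c = n → deg' b ≠ n →
    constantCoeff (f (Pi.single a 1) b) * constantCoeff (g (Pi.single b 1) c) = 0) :
    red deg deg'' n (g ∘ₗ f) = red deg' deg'' n g ∘ₗ red deg deg' n f := by
  refine LinearMap.ext fun v => funext fun c => ?_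
  have entry (a : {a // deg a = n}) : constantCoeff (g (f (Pi.single a.1 1)) c.1) =
      ∑ b : {b // deg' b = n},
        constantCoeff (f (Pi.single a.1 1) b.1) * constantCoeff (g (Pi.single b.1 1) c.1) := by
    conv_lhs => rw [eq_sum_smul_single (f (Pi.single a.1 1))]
    simp only [map_sum, map_smul, Finset.sum_apply, Pi.smul_apply, smul_eq_mul, map_mul]
    rw [← Finset.sum_subset (Finset.filter_subset (deg' · = n) _) fun b _ hb =>
      h _ _ _ a.2 c.2 (by simpa using hb), ← Finset.sum_subtype_eq_sum_filter, Finset.subtype_univ]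
  simp only [LinearMap.comp_apply, red_apply, entry, Finset.sum_mul, Finset.mul_sum]
  rw [Finset.sum_comm]
  exact Finset.sum_congr rfl fun b _ => Finset.sum_congr rfl fun a _ => by ring

theorem red_comp_of_left (hg : IsGraded deg' deg'' g) :
    red deg deg'' n (g ∘ₗ f) = red deg' deg'' n g ∘ₗ red deg deg' n f :=
  red_comp fun a b c _ hc hb => by
    rw [constantCoeff_eq_zero hg (hc.trans_ne hb.symm), mul_zero]

theorem red_comp_of_right (hf : IsGraded deg deg' f) :
    red deg deg'' n (g ∘ₗ f) = red deg' deg'' n g ∘ₗ red deg deg' n f :=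
  red_comp fun a b c ha _ hb => by
    rw [constantCoeff_eq_zero hf (hb.trans_eq ha.symm), zero_mul]

end Reduction

end GradedFree

/-! ### Comparison of graded free resolutions -/

theorem exists_seq_of_forall_exists_succ {α : ℕ → Type*} {P : ∀ i, α i → Prop}
    {r : ∀ i, α i → α (i + 1) → Prop} {x₀ : α 0} (zero : P 0 x₀)
    (succ : ∀ i x, P i x → ∃ y, P (i + 1) y ∧ r i x y) :
    ∃ x : ∀ i, α i, x 0 = x₀ ∧ (∀ i, P i (x i)) ∧ ∀ i, r i (x i) (x (i + 1)) := by
  choose next hP hr using succ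
  let x (i : ℕ) : {x // P i x} := Nat.rec ⟨x₀, zero⟩ (fun i x => ⟨next i x.1 x.2, hP i x.1 x.2⟩) i
  exact ⟨fun i => (x i).1, rfl, fun i => (x i).2, fun i => hr i (x i).1 (x i).2⟩

open GradedFree

/-- A graded free resolution of `R ⧸ I` by modules of finite rank, not necessarily minimal, with
arbitrary index types for the bases. -/
structure GradedFreeResolution {σ K : Type*} [Field K] (I : Ideal (MvPolynomial σ K)) where
  /-- the index types of the bases -/
  ι : ℕ → Type*
  [fintype : ∀ i, Fintype (ι i)]
  [decidableEq : ∀ i, DecidableEq (ι i)]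
  /-- the degrees of the basis elements -/
  deg : ∀ i, ι i → ℕ
  /-- the differential -/
  d : ∀ i, FreeMap σ K (ι (i + 1)) (ι i)
  /-- the augmentation -/
  aug : (ι 0 → MvPolynomial σ K) →ₗ[MvPolynomial σ K] (MvPolynomial σ K ⧸ I)
  d_graded : ∀ i, IsGraded (deg (i + 1)) (deg i) (d i)
  aug_graded : ∀ j, ∀ v ∈ gradedFreePiece (deg 0) j,
    ∃ f : MvPolynomial σ K, f.IsHomogeneous j ∧ aug v = Ideal.Quotient.mk I f
  aug_surjective : Function.Surjective aug
  exact_zero : Function.Exact (d 0) aug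
  exact_succ : ∀ i, Function.Exact (d (i + 1)) (d i)

attribute [instance] GradedFreeResolution.fintype GradedFreeResolution.decidableEq

namespace GradedFreeResolution

variable {σ K : Type*} [Field K] {I : Ideal (MvPolynomial σ K)}

section Comparison

variable (F G : GradedFreeResolution I)

theorem mem_range_d_zero {v} : v ∈ LinearMap.range (F.d 0) ↔ F.aug v = 0 := (F.exact_zero v).symm

theorem mem_range_d_succ {i : ℕ} {v} : v ∈ LinearMap.range (F.d (i + 1)) ↔ F.d i v = 0 :=
  (F.exact_succ i v).symm

theorem d_comp_d (i : ℕ) : F.d i ∘ₗ F.d (i + 1) = 0 := (F.exact_succ i).linearMap_comp_eq_zero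

theorem exists_aug_component_eq (v : F.ι 0 → MvPolynomial σ K) :
    ∃ f, F.aug v = Ideal.Quotient.mk I f ∧
      ∀ j, F.aug (component (F.deg 0) j v) = Ideal.Quotient.mk I (homogeneousComponent j f) := by
  induction v using piece_induction (F.deg 0) with
  | zero => exact ⟨0, by simp, by simp⟩
  | add v w hv hw =>
    obtain ⟨f, hf, hf'⟩ := hv
    obtain ⟨g, hg, hg'⟩ := hw
    exact ⟨f + g, by simp [hf, hg], fun j => by simp [hf', hg']⟩
  | homogeneous i v hv =>
    obtain ⟨f, hf, hvf⟩ := F.aug_graded i v hv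
    refine ⟨f, hvf, fun j => ?_⟩
    obtain rfl | hij := eq_or_ne i j
    · rw [component_eq_self hv, hvf, homogeneousComponent_eq_self hf]
    · rw [component_eq_zero hij hv, homogeneousComponent_of_mem hf, if_neg hij.symm, map_zero,
        map_zero]

theorem exists_mem_gradedFreePiece_aug_eq (hI : I.IsHomogeneous (homogeneousSubmodule σ K)) {j : ℕ}
    {f : MvPolynomial σ K} (hf : f.IsHomogeneous j) :
    ∃ w ∈ gradedFreePiece (F.deg 0) j, F.aug w = Ideal.Quotient.mk I f := by
  obtain ⟨v, hv⟩ := F.aug_surjective (Ideal.Quotient.mk I f)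
  obtain ⟨g, hg, hcomponent⟩ := F.exists_aug_component_eq v
  refine ⟨component (F.deg 0) j v, component_mem _ _ _, ?_⟩
  have hgf : homogeneousComponent j (g - f) ∈ I :=
    homogeneousComponent_mem_of_mem hI (Ideal.Quotient.eq.1 (hg.symm.trans hv)) j
  rw [map_sub, homogeneousComponent_eq_self hf] at hgf
  rw [hcomponent, Ideal.Quotient.eq]
  exact hgf

/-- A degree-preserving chain map between graded free resolutions of `R ⧸ I` over the identity of
`R ⧸ I`. -/
structure ChainMap where
  /-- the maps of the modules -/
  map : ∀ i, FreeMap σ K (F.ι i) (G.ι i)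
  isGraded : ∀ i, IsGraded (F.deg i) (G.deg i) (map i)
  d_comp : ∀ i, G.d i ∘ₗ map (i + 1) = map i ∘ₗ F.d i
  aug_comp : G.aug ∘ₗ map 0 = F.aug

theorem nonempty_chainMap (hI : I.IsHomogeneous (homogeneousSubmodule σ K)) :
    Nonempty (ChainMap F G) := by
  obtain ⟨u, hu, haug⟩ : ∃ u, IsGraded (F.deg 0) (G.deg 0) u ∧ G.aug ∘ₗ u = F.aug := by
    refine exists_isGraded_lift F.aug G.aug fun a => ?_
    obtain ⟨f, hf, hfa⟩ := F.aug_graded _ _ (single_one_mem (F.deg 0) a)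
    rw [hfa]
    exact G.exists_mem_gradedFreePiece_aug_eq hI hf
  obtain ⟨φ, rfl, hφ, hcomm⟩ := exists_seq_of_forall_exists_succ
    (α := fun i => FreeMap σ K (F.ι i) (G.ι i))
    (P := fun i φ => IsGraded (F.deg i) (G.deg i) φ ∧ ∀ v, φ (F.d i v) ∈ LinearMap.range (G.d i))
    (r := fun i φ ψ => G.d i ∘ₗ ψ = φ ∘ₗ F.d i) (x₀ := u)
    ⟨hu, fun v => by
      rw [mem_range_d_zero, ← LinearMap.comp_apply, haug, F.exact_zero.apply_apply_eq_zero]⟩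
    fun i φ ⟨hφ, hrange⟩ => by
      obtain ⟨ψ, hψ, hcomm⟩ := (hφ.comp (F.d_graded i)).exists_lift (G.d_graded i) hrange
      refine ⟨ψ, ⟨hψ, fun v => ?_⟩, hcomm⟩
      rw [mem_range_d_succ, ← LinearMap.comp_apply, hcomm, LinearMap.comp_apply,
        (F.exact_succ i).apply_apply_eq_zero, map_zero]
  exact ⟨⟨φ, fun i => (hφ i).1, hcomm, haug⟩⟩

end Comparison

namespace ChainMap

variable {F G H : GradedFreeResolution I}

/-- The identity chain map. -/
noncomputable def id (F : GradedFreeResolution I) : ChainMap F F where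
  map _ := LinearMap.id
  isGraded _ := IsGraded.id
  d_comp _ := rfl
  aug_comp := rfl

/-- The composite of two chain maps. -/
noncomputable def comp (ψ : ChainMap G H) (φ : ChainMap F G) : ChainMap F H where
  map i := ψ.map i ∘ₗ φ.map i
  isGraded i := (ψ.isGraded i).comp (φ.isGraded i)
  d_comp i := by
    rw [← LinearMap.comp_assoc, ψ.d_comp, LinearMap.comp_assoc, φ.d_comp, LinearMap.comp_assoc]
  aug_comp := by rw [← LinearMap.comp_assoc, ψ.aug_comp, φ.aug_comp]

theorem exists_homotopy (φ χ : ChainMap F G) :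
    ∃ h : ∀ i, FreeMap σ K (F.ι i) (G.ι (i + 1)),
      φ.map 0 - χ.map 0 = G.d 0 ∘ₗ h 0 ∧
      ∀ i, φ.map (i + 1) - χ.map (i + 1) = G.d (i + 1) ∘ₗ h (i + 1) + h i ∘ₗ F.d i := by
  have hcomm (i : ℕ) :
      G.d i ∘ₗ (φ.map (i + 1) - χ.map (i + 1)) = (φ.map i - χ.map i) ∘ₗ F.d i := by
    rw [LinearMap.comp_sub, LinearMap.sub_comp, φ.d_comp, χ.d_comp]
  obtain ⟨h₀, hh₀⟩ := exists_lift (φ.map 0 - χ.map 0) (G.d 0) fun v => by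
    rw [mem_range_d_zero, ← LinearMap.comp_apply, LinearMap.comp_sub, φ.aug_comp, χ.aug_comp,
      sub_self, LinearMap.zero_apply]
  obtain ⟨h, rfl, -, hh⟩ := exists_seq_of_forall_exists_succ
    (α := fun i => FreeMap σ K (F.ι i) (G.ι (i + 1)))
    (P := fun i h => G.d i ∘ₗ h ∘ₗ F.d i = (φ.map i - χ.map i) ∘ₗ F.d i)
    (r := fun i h h' => φ.map (i + 1) - χ.map (i + 1) = G.d (i + 1) ∘ₗ h' + h ∘ₗ F.d i)
    (x₀ := h₀) (by rw [← LinearMap.comp_assoc, hh₀]) fun i h hh => by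
      obtain ⟨h', hh'⟩ := exists_lift (φ.map (i + 1) - χ.map (i + 1) - h ∘ₗ F.d i) (G.d (i + 1))
        fun v => by
          rw [mem_range_d_succ, ← LinearMap.comp_apply, LinearMap.comp_sub, hcomm, hh, sub_self,
            LinearMap.zero_apply]
      refine ⟨h', ?_, by rw [hh', sub_add_cancel]⟩
      rw [← LinearMap.comp_assoc, hh', LinearMap.sub_comp, LinearMap.comp_assoc, F.d_comp_d,
        LinearMap.comp_zero, sub_zero]
  exact ⟨h, hh₀.symm, hh⟩

end ChainMap

/-! ### Betti numbers from arbitrary resolutions -/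

/-- The degree-`n` part of the `i`-th differential modulo the ideal generated by the variables. -/
noncomputable def redD (F : GradedFreeResolution I) (n i : ℕ) :
    ({a // F.deg (i + 1) a = n} → K) →ₗ[K] ({a // F.deg i a = n} → K) :=
  red (F.deg (i + 1)) (F.deg i) n (F.d i)

theorem redD_comp_redD (F : GradedFreeResolution I) (n i : ℕ) :
    F.redD n i ∘ₗ F.redD n (i + 1) = 0 := by
  rw [redD, redD, ← red_comp_of_left (F.d_graded i), F.d_comp_d, map_zero]

/-- The rank of the degree-`n` part modulo the variables of the differential leaving the `i`-th
module; the differential leaving the `0`-th module is zero. -/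
noncomputable def redRank (F : GradedFreeResolution I) (n : ℕ) : ℕ → ℕ
  | 0 => 0
  | i + 1 => Module.finrank K (LinearMap.range (F.redD n i))

namespace ChainMap

variable {F G H : GradedFreeResolution I}

/-- The degree-`n` part of a chain map modulo the ideal generated by the variables. -/
noncomputable def red (φ : ChainMap F G) (n i : ℕ) :
    ({a // F.deg i a = n} → K) →ₗ[K] ({b // G.deg i b = n} → K) :=
  GradedFree.red (F.deg i) (G.deg i) n (φ.map i)

theorem red_id (n i : ℕ) : (ChainMap.id F).red n i = LinearMap.id := GradedFree.red_id

theorem red_comp (ψ : ChainMap G H) (φ : ChainMap F G) (n i : ℕ) :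
    (ψ.comp φ).red n i = ψ.red n i ∘ₗ φ.red n i := red_comp_of_left (ψ.isGraded i)

theorem redD_comp_red (φ : ChainMap F G) (n i : ℕ) :
    G.redD n i ∘ₗ φ.red n (i + 1) = φ.red n i ∘ₗ F.redD n i := by
  rw [redD, redD, red, red, ← red_comp_of_left (G.d_graded i), φ.d_comp,
    red_comp_of_left (φ.isGraded i)]

theorem exists_red_homotopy (φ χ : ChainMap F G) (n : ℕ) :
    ∃ h : ∀ i, ({a // F.deg i a = n} → K) →ₗ[K] ({b // G.deg (i + 1) b = n} → K),
      φ.red n 0 - χ.red n 0 = G.redD n 0 ∘ₗ h 0 ∧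
      ∀ i, φ.red n (i + 1) - χ.red n (i + 1) =
        G.redD n (i + 1) ∘ₗ h (i + 1) + h i ∘ₗ F.redD n i := by
  obtain ⟨h, h₀, hsucc⟩ := φ.exists_homotopy χ
  refine ⟨fun i => GradedFree.red _ _ n (h i), ?_, fun i => ?_⟩
  · rw [red, red, ← map_sub, h₀, red_comp_of_left (G.d_graded 0), redD]
  · rw [red, red, ← map_sub, hsucc, map_add, red_comp_of_left (G.d_graded (i + 1)),
      red_comp_of_right (F.d_graded i), redD, redD]

end ChainMap

end GradedFreeResolution

theorem finrank_add_finrank_range_add_finrank_range {K V W₀ W W₂ : Type*} [Field K]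
    [AddCommGroup V] [Module K V] [AddCommGroup W₀] [Module K W₀] [AddCommGroup W] [Module K W]
    [AddCommGroup W₂] [Module K W₂] [FiniteDimensional K W] {D' : W₂ →ₗ[K] W} {D : W →ₗ[K] W₀}
    (hD : D ∘ₗ D' = 0) {φ : V →ₗ[K] W} {ψ : W →ₗ[K] V} (hψφ : ψ ∘ₗ φ = LinearMap.id)
    (hDφ : D ∘ₗ φ = 0) (hψD : ψ ∘ₗ D' = 0) {h : W₀ →ₗ[K] W} {h' : W →ₗ[K] W₂}
    (hφψ : φ ∘ₗ ψ - LinearMap.id = D' ∘ₗ h' + h ∘ₗ D) :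
    Module.finrank K V + Module.finrank K (LinearMap.range D') +
      Module.finrank K (LinearMap.range D) = Module.finrank K W := by
  have hinj : Function.Injective φ := Function.LeftInverse.injective (LinearMap.congr_fun hψφ)
  have hsup : LinearMap.range φ ⊔ LinearMap.range D' = LinearMap.ker D := by
    refine le_antisymm (sup_le (LinearMap.range_le_ker_iff.2 hDφ)
      (LinearMap.range_le_ker_iff.2 hD)) fun w hw => ?_
    have hw' : φ (ψ w) - w = D' (h' w) := by
      simpa [LinearMap.mem_ker.1 hw] using LinearMap.congr_fun hφψ w
    rw [← sub_sub_cancel (φ (ψ w)) w, hw']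
    exact Submodule.sub_mem_sup ⟨_, rfl⟩ ⟨_, rfl⟩
  have hinf : LinearMap.range φ ⊓ LinearMap.range D' = ⊥ := by
    rw [eq_bot_iff]
    rintro _ ⟨⟨v, rfl⟩, w, hw⟩
    have hv : v = 0 := calc
      v = ψ (φ v) := (LinearMap.congr_fun hψφ v).symm
      _ = ψ (D' w) := by rw [hw]
      _ = 0 := LinearMap.congr_fun hψD w
    simp [hv]
  have hdim := Submodule.finrank_sup_add_finrank_inf_eq (LinearMap.range φ) (LinearMap.range D')
  rw [hsup, hinf, finrank_bot, LinearMap.finrank_range_of_inj hinj] at hdim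
  have := D.finrank_range_add_finrank_ker
  omega

namespace MinimalGradedFreeResolution

variable {σ K : Type*} [Field K] {I : Ideal (MvPolynomial σ K)}

/-- A minimal graded free resolution, regarded as a graded free resolution. -/
def toGradedFreeResolution (F : MinimalGradedFreeResolution I) : GradedFreeResolution I where
  ι i := Fin (F.rank i)
  deg := F.deg
  d := F.d
  aug := F.aug
  d_graded := F.d_graded
  aug_graded := F.aug_graded
  aug_surjective := F.aug_surjective
  exact_zero := F.exact_zero
  exact_succ := F.exact_succ

theorem mem_span_range_X_iff {p : MvPolynomial σ K} :
    p ∈ Ideal.span (Set.range (X : σ → MvPolynomial σ K)) ↔ constantCoeff p = 0 := by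
  rw [← Set.image_univ, mem_ideal_span_X_image]
  refine ⟨fun h => ?_, fun h e he => ?_⟩
  · contrapose! h
    exact ⟨0, by simpa [mem_support_iff, constantCoeff_eq] using h, by simp⟩
  · obtain ⟨s, hs⟩ : ∃ s, e s ≠ 0 := by
      contrapose! he
      rw [show e = 0 from Finsupp.ext he, notMem_support_iff]
      exact h
    exact ⟨s, trivial, hs⟩

theorem redD_eq_zero (F : MinimalGradedFreeResolution I) (n i : ℕ) :
    F.toGradedFreeResolution.redD n i = 0 := by
  refine LinearMap.ext fun v => _root_.funext fun b => ?_
  rw [GradedFreeResolution.redD, red_apply]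
  exact Finset.sum_eq_zero fun a _ =>
    mul_eq_zero_of_left (mem_span_range_X_iff.1 (F.minimal i _ b.1)) _

theorem betti_eq_finrank (F : MinimalGradedFreeResolution I) (i n : ℕ) :
    F.betti i n = Module.finrank K ({a // F.toGradedFreeResolution.deg i a = n} → K) := by
  rw [Module.finrank_fintype_fun_eq_card]
  exact (Fintype.card_subtype _).symm

/-- Modulo the variables a minimal resolution has zero differential, so its `i`-th Betti number is
the dimension of the homology of any other resolution modulo the variables. -/
theorem betti_add_redRank (F : MinimalGradedFreeResolution I) (G : GradedFreeResolution I)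
    (hI : I.IsHomogeneous (homogeneousSubmodule σ K)) (i n : ℕ) :
    F.betti i n + G.redRank n (i + 1) + G.redRank n i = Fintype.card {a // G.deg i a = n} := by
  obtain ⟨φ⟩ := F.toGradedFreeResolution.nonempty_chainMap G hI
  obtain ⟨ψ⟩ := G.nonempty_chainMap F.toGradedFreeResolution hI
  have hDφ (i : ℕ) : G.redD n i ∘ₗ φ.red n (i + 1) = 0 := by
    rw [φ.redD_comp_red, F.redD_eq_zero, LinearMap.comp_zero]
  have hψD (i : ℕ) : ψ.red n i ∘ₗ G.redD n i = 0 := by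
    rw [← ψ.redD_comp_red, F.redD_eq_zero, LinearMap.zero_comp]
  have hψφ (i : ℕ) : ψ.red n i ∘ₗ φ.red n i = LinearMap.id := by
    obtain ⟨h, h₀, hsucc⟩ := (ψ.comp φ).exists_red_homotopy (.id _) n
    rw [← sub_eq_zero, ← ψ.red_comp φ, ← GradedFreeResolution.ChainMap.red_id]
    cases i with
    | zero => rw [h₀, F.redD_eq_zero, LinearMap.zero_comp]
    | succ i => rw [hsucc, F.redD_eq_zero, F.redD_eq_zero, LinearMap.zero_comp,
        LinearMap.comp_zero, add_zero]
  obtain ⟨h, h₀, hsucc⟩ := (φ.comp ψ).exists_red_homotopy (.id _) n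
  simp only [φ.red_comp, GradedFreeResolution.ChainMap.red_id] at h₀ hsucc
  rw [F.betti_eq_finrank, ← Module.finrank_fintype_fun_eq_card K]
  cases i with
  | zero =>
    have hzero := finrank_add_finrank_range_add_finrank_range
      (D := (0 : ({a // G.deg 0 a = n} → K) →ₗ[K] K)) (h := 0) (LinearMap.zero_comp _) (hψφ 0)
      (LinearMap.zero_comp _) (hψD 0) (h₀.trans (add_zero _).symm)
    rwa [LinearMap.range_zero, finrank_bot] at hzero
  | succ i =>
    exact finrank_add_finrank_range_add_finrank_range (G.redD_comp_redD n i) (hψφ (i + 1)) (hDφ i)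
      (hψD (i + 1)) (hsucc i)

end MinimalGradedFreeResolution

/-! ### The Taylor resolution of a monomial ideal -/

/-- The ideal generated by the monomials with exponent vectors `m x`. -/
noncomputable def monomialIdeal {α σ : Type*} (R : Type*) [CommSemiring R] (m : α → σ →₀ ℕ) :
    Ideal (MvPolynomial σ R) :=
  Ideal.span (Set.range fun x => monomial (m x) 1)

theorem mem_monomialIdeal {α σ R : Type*} [CommSemiring R] {m : α → σ →₀ ℕ}
    {p : MvPolynomial σ R} : p ∈ monomialIdeal R m ↔ ∀ e ∈ p.support, ∃ x, m x ≤ e := by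
  rw [monomialIdeal, Set.range_comp' (fun e => monomial e 1) m, mem_ideal_span_monomial_image]
  simp

theorem isHomogeneous_monomialIdeal {α σ R : Type*} [CommSemiring R] (m : α → σ →₀ ℕ) :
    (monomialIdeal R m).IsHomogeneous (homogeneousSubmodule σ R) := by
  refine Ideal.homogeneous_span _ _ ?_
  rintro _ ⟨x, rfl⟩
  exact ⟨(m x).degree, isHomogeneous_monomial 1 rfl⟩

theorem monomialIdeal_le_span_range_X {α σ K : Type*} [Field K] {m : α → σ →₀ ℕ}
    (hm : ∀ x, m x ≠ 0) :
    monomialIdeal K m ≤ Ideal.span (Set.range (X : σ → MvPolynomial σ K)) := by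
  classical
  refine Ideal.span_le.2 ?_
  rintro _ ⟨x, rfl⟩
  rw [SetLike.mem_coe, MinimalGradedFreeResolution.mem_span_range_X_iff, constantCoeff_monomial,
    if_neg (hm x)]

namespace Taylor

section Simplex

variable {α R : Type*} [LinearOrder α] [CommRing R]

/-- The incidence sign of `A` in `insert x A`. -/
def sgn (R : Type*) [CommRing R] (A : Finset α) (x : α) : R := (-1) ^ (A.filter (· < x)).card

theorem sgn_mul_self (A : Finset α) (x : α) : sgn R A x * sgn R A x = 1 := by
  rw [sgn, ← mul_pow, neg_one_mul, neg_neg, one_pow]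

theorem sgn_insert {A : Finset α} {y : α} (hy : y ∉ A) (x : α) :
    sgn R (insert y A) x = if y < x then -sgn R A x else sgn R A x := by
  rw [sgn, Finset.filter_insert]
  split_ifs with h
  · rw [Finset.card_insert_of_notMem (by simp [hy]), pow_succ, mul_neg_one, sgn]
  · rfl

theorem sgn_insert_mul_sgn_insert {A : Finset α} {x y : α} (hx : x ∉ A) (hy : y ∉ A)
    (hxy : x ≠ y) : sgn R (insert x A) y * sgn R (insert y A) x = -(sgn R A x * sgn R A y) := by
  rw [sgn_insert hx, sgn_insert hy]
  rcases hxy.lt_or_gt with h | h <;> simp only [h, h.not_gt, if_true, if_false] <;> ring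

theorem sgn_mul_sgn_insert {A : Finset α} {x y : α} (hx : x ∉ A) (hy : y ∉ A) (hxy : x ≠ y) :
    sgn R A x * sgn R (insert x A) y = -(sgn R A y * sgn R (insert y A) x) := by
  rw [sgn_insert hx, sgn_insert hy]
  rcases hxy.lt_or_gt with h | h <;> simp only [h, h.not_gt, if_true, if_false] <;> ring

/-- The cone from the vertex `x₀`, a contracting homotopy of the full simplex. -/
def cone (x₀ : α) (g : Finset α → R) (A : Finset α) : R :=
  if x₀ ∈ A then sgn R (A.erase x₀) x₀ * g (A.erase x₀) else 0

theorem cone_insert {x₀ : α} {A : Finset α} (h : x₀ ∉ A) (g : Finset α → R) :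
    cone x₀ g (insert x₀ A) = sgn R A x₀ * g A := by
  rw [cone, if_pos (Finset.mem_insert_self _ _), Finset.erase_insert h]

theorem cone_of_notMem {x₀ : α} {A : Finset α} (h : x₀ ∉ A) (g : Finset α → R) :
    cone x₀ g A = 0 := if_neg h

variable [Fintype α]

/-- The boundary operator of the augmented simplicial chain complex of the full simplex on `α`. -/
def boundary (g : Finset α → R) (A : Finset α) : R := ∑ x ∈ Aᶜ, sgn R A x * g (insert x A)

theorem boundary_zero : boundary (0 : Finset α → R) = 0 := by
  funext A
  simp [boundary]

theorem boundary_boundary (g : Finset α → R) : boundary (boundary g) = 0 := by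
  funext A
  simp only [boundary, Finset.mul_sum, ← mul_assoc, Pi.zero_apply]
  rw [Finset.sum_sigma']
  refine Finset.sum_involution (fun p _ => ⟨p.2, p.1⟩) ?_ ?_ ?_ fun _ _ => rfl
  · rintro ⟨x, y⟩ h
    simp only [Finset.mem_sigma, Finset.mem_compl, Finset.mem_insert, not_or] at h
    rw [sgn_mul_sgn_insert h.1 h.2.2 (Ne.symm h.2.1), Finset.insert_comm x y]
    ring
  · rintro ⟨x, y⟩ h _ hxy
    simp only [Finset.mem_sigma, Finset.mem_compl, Finset.mem_insert, not_or] at h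
    exact h.2.1 (congrArg Sigma.fst hxy)
  · rintro ⟨x, y⟩ h
    simp only [Finset.mem_sigma, Finset.mem_compl, Finset.mem_insert, not_or] at h ⊢
    exact ⟨h.2.2, Ne.symm h.2.1, h.1⟩

theorem boundary_cone_add_cone_boundary (x₀ : α) (g : Finset α → R) :
    boundary (cone x₀ g) + cone x₀ (boundary g) = g := by
  funext A
  rw [Pi.add_apply]
  by_cases hA : x₀ ∈ A
  · obtain ⟨B, hB, rfl⟩ : ∃ B, x₀ ∉ B ∧ insert x₀ B = A :=
      ⟨A.erase x₀, Finset.notMem_erase _ _, Finset.insert_erase hA⟩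
    have hcompl : Bᶜ = insert x₀ (insert x₀ B)ᶜ := by
      rw [Finset.compl_insert, Finset.insert_erase (Finset.mem_compl.2 hB)]
    have hcancel : ∀ x ∈ (insert x₀ B)ᶜ,
        sgn R (insert x₀ B) x * cone x₀ g (insert x (insert x₀ B)) =
          -(sgn R B x₀ * (sgn R B x * g (insert x B))) := by
      intro x hx
      simp only [Finset.mem_compl, Finset.mem_insert, not_or] at hx
      rw [Finset.insert_comm, cone_insert (by simp [Ne.symm hx.1, hB]), ← mul_assoc,
        sgn_insert_mul_sgn_insert hB hx.2 (Ne.symm hx.1), neg_mul, mul_assoc]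
    rw [cone_insert hB, boundary, boundary, Finset.sum_congr rfl hcancel, hcompl,
      Finset.sum_insert (by simp), Finset.sum_neg_distrib, ← Finset.mul_sum, mul_add, ← mul_assoc,
      sgn_mul_self, one_mul]
    ring
  · rw [cone_of_notMem hA, add_zero, boundary, Finset.sum_eq_single x₀, cone_insert hA,
      ← mul_assoc, sgn_mul_self, one_mul]
    · exact fun x _ hx => by rw [cone_of_notMem (by simp [hA, Ne.symm hx]), mul_zero]
    · exact fun h => absurd (Finset.mem_compl.2 hA) h

end Simplex

section TotalComplex

variable {α σ R : Type*} [CommRing R] (m : α → σ →₀ ℕ)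

/-- The strand of a vector in the multidegree `w`: the coefficients of its terms of this
multidegree, where the basis vector of `A` has multidegree `A.sup m`. -/
noncomputable def strand (v : Finset α → MvPolynomial σ R) (w : σ →₀ ℕ) (A : Finset α) : R :=
  if A.sup m ≤ w then coeff (w - A.sup m) (v A) else 0

theorem strand_zero (w : σ →₀ ℕ) : strand m (0 : Finset α → MvPolynomial σ R) w = 0 := by
  funext A
  simp [strand]

theorem sup_le_of_strand_ne_zero {v : Finset α → MvPolynomial σ R} {w : σ →₀ ℕ} {A : Finset α}
    (h : strand m v w A ≠ 0) : A.sup m ≤ w := (ite_ne_right_iff.1 h).1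

theorem ext_strand {v v' : Finset α → MvPolynomial σ R} (h : strand m v = strand m v') :
    v = v' := by
  ext A e
  simpa [strand] using congrFun (congrFun h (e + A.sup m)) A

theorem finite_setOf_strand_ne_zero [Finite α] (v : Finset α → MvPolynomial σ R) :
    {w | strand m v w ≠ 0}.Finite := by
  refine (Set.finite_iUnion fun A => ((v A).support.finite_toSet.image (· + A.sup m))).subset
    fun w hw => ?_
  obtain ⟨A, hA⟩ := Function.ne_iff.1 hw
  obtain ⟨hle, hcoeff⟩ := ite_ne_right_iff.1 hA
  exact Set.mem_iUnion.2 ⟨A, w - A.sup m, mem_support_iff.2 hcoeff, tsub_add_cancel_of_le hle⟩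

theorem exists_strand_eq {g : (σ →₀ ℕ) → Finset α → R} (hfin : {w | g w ≠ 0}.Finite)
    (hg : ∀ w A, g w A ≠ 0 → A.sup m ≤ w) : ∃ u, strand m u = g := by
  classical
  refine ⟨fun A => ∑ w ∈ hfin.toFinset, monomial (w - A.sup m) (g w A), ?_⟩
  funext w A
  rw [strand]
  split_ifs with hA
  · rw [coeff_sum, Finset.sum_eq_single w, coeff_monomial, if_pos rfl]
    · intro w' _ hne
      rw [coeff_monomial, ite_eq_right_iff]
      intro hw
      by_contra h
      exact hne ((tsub_left_inj (hg _ _ h) hA).1 hw)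
    · intro hw
      simp_all
  · by_contra h
    exact hA (hg w A (Ne.symm h))

variable [LinearOrder α] [Fintype α]

/-- The differential of the total Taylor complex, whose basis consists of all subsets of `α`. -/
noncomputable def diff :
    (Finset α → MvPolynomial σ R) →ₗ[MvPolynomial σ R] (Finset α → MvPolynomial σ R) :=
  LinearMap.pi fun A => ∑ x ∈ Aᶜ,
    monomial ((insert x A).sup m - A.sup m) (sgn R A x) • LinearMap.proj (insert x A)

theorem diff_apply (v : Finset α → MvPolynomial σ R) (A : Finset α) :
    diff m v A = ∑ x ∈ Aᶜ,
      monomial ((insert x A).sup m - A.sup m) (sgn R A x) * v (insert x A) := by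
  simp [diff]

theorem strand_diff (v : Finset α → MvPolynomial σ R) (w : σ →₀ ℕ) :
    strand m (diff m v) w = boundary (strand m v w) := by
  funext A
  have hmono (x : α) : A.sup m ≤ (insert x A).sup m := Finset.sup_mono (Finset.subset_insert x A)
  by_cases hA : A.sup m ≤ w
  · rw [strand, if_pos hA, diff_apply, coeff_sum]
    refine Finset.sum_congr rfl fun x _ => ?_
    simp only [coeff_monomial_mul', strand, mul_ite, mul_zero, tsub_le_iff_right,
      tsub_add_cancel_of_le hA, tsub_tsub_tsub_cancel_right (hmono x)]
  · rw [strand, if_neg hA]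
    refine (Finset.sum_eq_zero fun x _ => ?_).symm
    rw [strand, if_neg fun h => hA ((hmono x).trans h), mul_zero]

theorem diff_diff (v : Finset α → MvPolynomial σ R) : diff m (diff m v) = 0 :=
  ext_strand m <| funext fun w => by
    rw [strand_diff, strand_diff, boundary_boundary, strand_zero]

/-- If some generator divides `x^w`, it is the apex of a cone that contracts the strand in the
multidegree `w`; otherwise only the coefficient at `∅` can be nonzero. -/
theorem exists_boundary_eq_strand {v : Finset α → MvPolynomial σ R} (hv : diff m v = 0)
    (h₀ : v ∅ ∈ monomialIdeal R m) (w : σ →₀ ℕ) :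
    ∃ h : Finset α → R, boundary h = strand m v w ∧ (∀ A, h A ≠ 0 → A.sup m ≤ w) ∧
      (strand m v w = 0 → h = 0) := by
  by_cases hw : ∃ x₀, m x₀ ≤ w
  · obtain ⟨x₀, hx₀⟩ := hw
    refine ⟨cone x₀ (strand m v w), ?_, fun A hA => ?_, fun hzero => ?_⟩
    · have hcycle : boundary (strand m v w) = 0 := by rw [← strand_diff, hv, strand_zero]
      have hcone := boundary_cone_add_cone_boundary x₀ (strand m v w)
      rw [hcycle] at hcone
      simpa [funext_iff, cone] using hcone
    · obtain ⟨hmem, hne⟩ := ite_ne_right_iff.1 hA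
      rw [← Finset.insert_erase hmem, Finset.sup_insert]
      exact sup_le hx₀ (sup_le_of_strand_ne_zero m (right_ne_zero_of_mul hne))
    · funext A
      simp [hzero, cone]
  · have hzero : strand m v w = 0 := by
      funext A
      by_contra hA
      obtain rfl | ⟨x, hx⟩ := A.eq_empty_or_nonempty
      · rw [strand, Finset.sup_empty, bot_eq_zero, if_pos zero_le, tsub_zero] at hA
        exact hw (mem_monomialIdeal.1 h₀ w (mem_support_iff.2 hA))
      · exact hw ⟨x, (Finset.le_sup hx).trans (sup_le_of_strand_ne_zero m hA)⟩
    exact ⟨0, by rw [boundary_zero, hzero], fun A hA => absurd rfl hA, fun _ => rfl⟩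

theorem exists_diff_eq {v : Finset α → MvPolynomial σ R} (hv : diff m v = 0)
    (h₀ : v ∅ ∈ monomialIdeal R m) : ∃ u, diff m u = v := by
  choose h hboundary hsup hzero using exists_boundary_eq_strand m hv h₀
  obtain ⟨u, hu⟩ := exists_strand_eq m
    ((finite_setOf_strand_ne_zero m v).subset fun w hw => mt (hzero w) hw) hsup
  exact ⟨u, ext_strand m <| funext fun w => by rw [strand_diff, hu, hboundary]⟩

theorem diff_single_insert {A : Finset α} {x : α} (hx : x ∉ A) :
    diff m (Pi.single (insert x A) (1 : MvPolynomial σ R)) A =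
      monomial ((insert x A).sup m - A.sup m) (sgn R A x) := by
  rw [diff_apply, Finset.sum_eq_single x, Pi.single_eq_same, mul_one]
  · intro y hy hne
    rw [Pi.single_eq_of_ne, mul_zero]
    exact fun h => hne ((Finset.insert_inj (Finset.mem_compl.1 hy)).1 h)
  · exact fun h => absurd (Finset.mem_compl.2 hx) h

theorem diff_single_of_not_subset {A B : Finset α} (h : ¬A ⊆ B) :
    diff m (Pi.single B (1 : MvPolynomial σ R)) A = 0 := by
  rw [diff_apply]
  refine Finset.sum_eq_zero fun x _ => ?_
  rw [Pi.single_eq_of_ne, mul_zero]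
  exact fun hB => h (hB ▸ Finset.subset_insert x A)

end TotalComplex

section Resolution

variable {α σ R : Type*}

/-- Extension by zero from the subsets of cardinality `i` to all subsets. -/
noncomputable def extend [CommSemiring R] (i : ℕ) :
    FreeMap σ R {S : Finset α // S.card = i} (Finset α) :=
  Function.ExtendByZero.linearMap _ Subtype.val

theorem extend_apply [CommSemiring R] {i : ℕ} (v : {S : Finset α // S.card = i} → MvPolynomial σ R)
    (S : {S : Finset α // S.card = i}) : extend i v S.1 = v S :=
  Subtype.val_injective.extend_apply _ _ _

theorem extend_apply_of_ne [CommSemiring R] {i : ℕ}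
    (v : {S : Finset α // S.card = i} → MvPolynomial σ R) {S : Finset α} (h : S.card ≠ i) :
    extend i v S = 0 :=
  Function.extend_apply' _ _ _ fun ⟨T, hT⟩ => h (by rw [← hT, T.2])

theorem extend_single [CommSemiring R] [DecidableEq α] {i : ℕ} (B : {S : Finset α // S.card = i}) :
    extend i (Pi.single B (1 : MvPolynomial σ R)) = Pi.single B.1 1 := by
  funext A
  by_cases hA : A.card = i
  · rw [extend_apply _ ⟨A, hA⟩]
    simp [Pi.single_apply, Subtype.ext_iff]
  · rw [extend_apply_of_ne _ hA, Pi.single_eq_of_ne fun h => hA (by rw [h, B.2])]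

variable [LinearOrder α] [Fintype α] [CommRing R] (m : α → σ →₀ ℕ)

/-- The differential of the Taylor complex in homological degree `i + 1`. -/
noncomputable def d (i : ℕ) :
    FreeMap σ R {S : Finset α // S.card = i + 1} {S : Finset α // S.card = i} :=
  LinearMap.funLeft _ _ Subtype.val ∘ₗ diff m ∘ₗ extend (i + 1)

theorem d_apply {i : ℕ} (v : {S : Finset α // S.card = i + 1} → MvPolynomial σ R)
    (A : {S : Finset α // S.card = i}) : d m i v A = diff m (extend (i + 1) v) A.1 := rfl

theorem extend_d (i : ℕ) (v : {S : Finset α // S.card = i + 1} → MvPolynomial σ R) :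
    extend i (d m i v) = diff m (extend (i + 1) v) := by
  funext A
  by_cases hA : A.card = i
  · rw [extend_apply _ ⟨A, hA⟩, d_apply]
  · rw [extend_apply_of_ne _ hA, diff_apply]
    refine (Finset.sum_eq_zero fun x hx => ?_).symm
    rw [extend_apply_of_ne, mul_zero]
    rwa [Finset.card_insert_of_notMem (Finset.mem_compl.1 hx), Ne, add_left_inj]

theorem d_comp_d (i : ℕ) (v : {S : Finset α // S.card = i + 1 + 1} → MvPolynomial σ R) :
    d m i (d m (i + 1) v) = 0 := by
  funext A
  rw [d_apply, extend_d, diff_diff, Pi.zero_apply, Pi.zero_apply]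

theorem exists_d_eq {i : ℕ} {v : {S : Finset α // S.card = i} → MvPolynomial σ R}
    (hv : diff m (extend i v) = 0) (h₀ : extend i v ∅ ∈ monomialIdeal R m) :
    ∃ u, d m i u = v := by
  obtain ⟨u, hu⟩ := exists_diff_eq m hv h₀
  refine ⟨fun S => u S.1, funext fun A => ?_⟩
  rw [← extend_apply v A, ← hu, d_apply, diff_apply, diff_apply]
  refine Finset.sum_congr rfl fun x hx => ?_
  have hcard : (insert x A.1).card = i + 1 := by
    rw [Finset.card_insert_of_notMem (Finset.mem_compl.1 hx), A.2]
  rw [extend_apply _ ⟨insert x A.1, hcard⟩]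

theorem d_single_apply {i : ℕ} (B : {S : Finset α // S.card = i + 1})
    (A : {S : Finset α // S.card = i}) :
    d m i (Pi.single B (1 : MvPolynomial σ R)) A = diff m (Pi.single B.1 1) A.1 := by
  rw [d_apply, extend_single]

theorem d_single_of_not_subset {i : ℕ} {B : {S : Finset α // S.card = i + 1}}
    {A : {S : Finset α // S.card = i}} (h : ¬A.1 ⊆ B.1) :
    d m i (Pi.single B (1 : MvPolynomial σ R)) A = 0 := by
  rw [d_single_apply, diff_single_of_not_subset m h]

theorem constantCoeff_d_single_ne_zero [Nontrivial R] {i : ℕ}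
    {B : {S : Finset α // S.card = i + 1}} {A : {S : Finset α // S.card = i}} (h : A.1 ⊆ B.1)
    (hdeg : (A.1.sup m).degree = (B.1.sup m).degree) :
    constantCoeff (d m i (Pi.single B (1 : MvPolynomial σ R)) A) ≠ 0 := by
  classical
  have hsup : B.1.sup m - A.1.sup m = 0 := by
    rw [← Finsupp.degree_eq_zero_iff]
    have hadd := congrArg Finsupp.degree (tsub_add_cancel_of_le (Finset.sup_mono (f := m) h))
    rw [map_add] at hadd
    omega
  obtain ⟨x, hx, hB⟩ := Finset.exists_eq_insert_iff.2 ⟨h, by rw [A.2, B.2]⟩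
  rw [d_single_apply, ← hB, diff_single_insert m hx, hB, hsup, constantCoeff_monomial, if_pos rfl]
  exact left_ne_zero_of_mul_eq_one (sgn_mul_self A.1 x)

variable {K : Type*} [Field K]

theorem isGraded_d (i : ℕ) : IsGraded (fun S => (S.1.sup m).degree) (fun S => (S.1.sup m).degree)
    (d m i : FreeMap σ K {S : Finset α // S.card = i + 1} {S : Finset α // S.card = i}) := by
  classical
  refine isGraded_of_basis fun B => mem_gradedFreePiece.2 fun A e he => ?_
  rw [d_single_apply] at he
  by_cases hAB : A.1 ⊆ B.1
  · obtain ⟨x, hx, hB⟩ := Finset.exists_eq_insert_iff.2 ⟨hAB, by rw [A.2, B.2]⟩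
    rw [← hB, diff_single_insert m hx, hB, coeff_monomial] at he
    rw [← (ite_ne_right_iff.1 he).1, ← map_add, tsub_add_cancel_of_le (Finset.sup_mono hAB)]
  · simp [diff_single_of_not_subset m hAB] at he

/-- The Taylor resolution of the ideal generated by the monomials with exponent vectors `m x`. -/
noncomputable def resolution (K : Type*) [Field K] (m : α → σ →₀ ℕ) :
    GradedFreeResolution (monomialIdeal K m) where
  ι i := {S : Finset α // S.card = i}
  deg i S := (S.1.sup m).degree
  d i := d m i
  aug := Submodule.mkQ _ ∘ₗ LinearMap.proj ⟨∅, Finset.card_empty⟩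
  d_graded i := isGraded_d m i
  aug_graded j v hv := by
    refine ⟨v ⟨∅, Finset.card_empty⟩, fun e he => ?_, rfl⟩
    have hdeg := mem_gradedFreePiece.1 hv _ _ he
    rw [Finset.sup_empty, bot_eq_zero, map_zero, add_zero] at hdeg
    rw [← hdeg, Finsupp.degree_eq_weight_one]
    rfl
  aug_surjective f := by
    obtain ⟨f, rfl⟩ := Submodule.mkQ_surjective _ f
    exact ⟨fun _ => f, rfl⟩
  exact_zero v := by
    rw [LinearMap.comp_apply, Submodule.mkQ_apply, Submodule.Quotient.mk_eq_zero,
      LinearMap.proj_apply]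
    constructor
    · intro hv
      refine exists_d_eq m (funext fun A => ?_) (by rwa [extend_apply v ⟨∅, Finset.card_empty⟩])
      rw [diff_apply]
      exact Finset.sum_eq_zero fun x _ => by rw [extend_apply_of_ne _ (by simp), mul_zero]
    · rintro ⟨u, rfl⟩
      rw [d_apply, diff_apply]
      refine Ideal.sum_mem _ fun x _ => Ideal.mul_mem_right _ _ ?_
      exact mem_monomialIdeal.2 fun e he => ⟨x, by
        rw [Finset.mem_singleton.1 (support_monomial_subset he)]
        simp [bot_eq_zero]⟩
  exact_succ i v := by
    constructor
    · intro hv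
      refine exists_d_eq m (by rw [← extend_d, hv, map_zero]) ?_
      rw [extend_apply_of_ne _ (by simp)]
      exact zero_mem _
    · rintro ⟨u, rfl⟩
      exact d_comp_d m i u

end Resolution

end Taylor

/-! ### Discrete Morse theory on the Taylor resolution -/

open scoped Finset

/-- An acyclic matching, in the sense of discrete Morse theory, on a family `𝒞` of finite sets: a
set with a pivot `q` is matched with the set obtained from it by removing or adding `q`. Acyclicity
is expressed by a weight which increases strictly along the gradient paths. -/
structure AcyclicMatching {α : Type*} [DecidableEq α] (𝒞 : Finset (Finset α)) (β : Type*)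
    [Preorder β] where
  /-- the pivots of a set -/
  IsPivot : Finset α → α → Prop
  unique {A q q'} : IsPivot A q → IsPivot A q' → q = q'
  erase {A q} : A ∈ 𝒞 → q ∈ A → IsPivot A q → A.erase q ∈ 𝒞 ∧ IsPivot (A.erase q) q
  insert {A q} : A ∈ 𝒞 → q ∉ A → IsPivot A q → insert q A ∈ 𝒞 ∧ IsPivot (insert q A) q
  /-- the weight of a set with a given pivot -/
  weight : Finset α → α → β
  weight_lt {A B q q'} : q ∈ A → IsPivot A q → q' ∈ B → IsPivot B q' → A.erase q ⊆ B →
    #B = #A → B ≠ A → weight A q < weight B q'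

namespace AcyclicMatching

section Counting

variable {α β : Type*} [DecidableEq α] [Preorder β] {𝒞 : Finset (Finset α)}
  (M : AcyclicMatching 𝒞 β)

open Classical in
/-- The matched sets that contain their pivot. -/
noncomputable def upper : Finset (Finset α) := {A ∈ 𝒞 | ∃ q ∈ A, M.IsPivot A q}

open Classical in
/-- The matched sets that do not contain their pivot. -/
noncomputable def lower : Finset (Finset α) := {A ∈ 𝒞 | ∃ q ∉ A, M.IsPivot A q}

open Classical in
/-- The unmatched sets. -/
noncomputable def critical : Finset (Finset α) := {A ∈ 𝒞 | ∀ q, ¬M.IsPivot A q}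

variable {M} {A : Finset α} {i : ℕ}

theorem mem_upper : A ∈ M.upper ↔ A ∈ 𝒞 ∧ ∃ q ∈ A, M.IsPivot A q := by
  simp [upper]

theorem mem_lower : A ∈ M.lower ↔ A ∈ 𝒞 ∧ ∃ q ∉ A, M.IsPivot A q := by
  simp [lower]

theorem mem_critical : A ∈ M.critical ↔ A ∈ 𝒞 ∧ ∀ q, ¬M.IsPivot A q := by
  simp [critical]

variable (M)

theorem card_lower_slice (i : ℕ) : #(M.lower.slice i) = #(M.upper.slice (i + 1)) := by
  have hlower : ∀ A ∈ M.lower.slice i, A ∈ 𝒞 ∧ #A = i ∧ ∃ q ∉ A, M.IsPivot A q := fun A hA => by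
    obtain ⟨hA, hcard⟩ := Finset.mem_slice.1 hA
    exact ⟨(mem_lower.1 hA).1, hcard, (mem_lower.1 hA).2⟩
  have hupper : ∀ A ∈ M.upper.slice (i + 1), A ∈ 𝒞 ∧ #A = i + 1 ∧ ∃ q ∈ A, M.IsPivot A q :=
    fun A hA => by
      obtain ⟨hA, hcard⟩ := Finset.mem_slice.1 hA
      exact ⟨(mem_upper.1 hA).1, hcard, (mem_upper.1 hA).2⟩
  choose hC hcard p hp hpivot using hlower
  choose hC' hcard' p' hp' hpivot' using hupper
  have hinsert (A) (hA : A ∈ M.lower.slice i) :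
      Insert.insert (p A hA) A ∈ M.upper.slice (i + 1) := by
    have hmatched := M.insert (hC A hA) (hp A hA) (hpivot A hA)
    exact Finset.mem_slice.2 ⟨mem_upper.2 ⟨hmatched.1, _, Finset.mem_insert_self _ _, hmatched.2⟩,
      by rw [Finset.card_insert_of_notMem (hp A hA), hcard A hA]⟩
  have herase (A) (hA : A ∈ M.upper.slice (i + 1)) : A.erase (p' A hA) ∈ M.lower.slice i := by
    have hmatched := M.erase (hC' A hA) (hp' A hA) (hpivot' A hA)
    exact Finset.mem_slice.2 ⟨mem_lower.2 ⟨hmatched.1, _, Finset.notMem_erase _ _, hmatched.2⟩,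
      by rw [Finset.card_erase_of_mem (hp' A hA), hcard' A hA, Nat.add_sub_cancel]⟩
  refine Finset.card_bij' (fun A hA => Insert.insert (p A hA) A) (fun A hA => A.erase (p' A hA))
    hinsert herase (fun A hA => ?_) fun A hA => ?_
  · have hp_eq := M.unique (hpivot' _ (hinsert A hA))
      (M.insert (hC A hA) (hp A hA) (hpivot A hA)).2
    exact (congrArg _ hp_eq).trans (Finset.erase_insert (hp A hA))
  · have hp_eq := M.unique (hpivot _ (herase A hA))
      (M.erase (hC' A hA) (hp' A hA) (hpivot' A hA)).2
    exact (congrArg (Insert.insert · _) hp_eq).trans (Finset.insert_erase (hp' A hA))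

theorem card_slice (i : ℕ) :
    #(𝒞.slice i) = #(M.upper.slice i) + #(M.upper.slice (i + 1)) + #(M.critical.slice i) := by
  have hpartition : 𝒞.slice i = M.upper.slice i ∪ M.lower.slice i ∪ M.critical.slice i := by
    ext A
    simp only [Finset.mem_union, Finset.mem_slice, mem_upper, mem_lower, mem_critical]
    grind
  have hmatched : Disjoint (M.upper.slice i) (M.lower.slice i) := by
    refine Finset.disjoint_left.2 fun A hu hl => ?_
    obtain ⟨q, hq, hpivot⟩ := (mem_upper.1 (Finset.mem_slice.1 hu).1).2
    obtain ⟨q', hq', hpivot'⟩ := (mem_lower.1 (Finset.mem_slice.1 hl).1).2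
    exact hq' (M.unique hpivot hpivot' ▸ hq)
  have hunmatched : Disjoint (M.upper.slice i ∪ M.lower.slice i) (M.critical.slice i) := by
    refine Finset.disjoint_left.2 fun A hA hc => ?_
    simp only [Finset.mem_union, Finset.mem_slice, mem_upper, mem_lower, mem_critical] at hA hc
    grind
  rw [hpartition, Finset.card_union_of_disjoint hunmatched, Finset.card_union_of_disjoint hmatched,
    card_lower_slice]

theorem slice_critical {i₀ : ℕ} (h : ∀ A ∈ M.critical, #A = i₀) (i : ℕ) :
    M.critical.slice i = if i = i₀ then M.critical else ∅ := by
  split_ifs with hi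
  · exact Finset.filter_true_of_mem fun A hA => (h A hA).trans hi.symm
  · exact Finset.filter_false_of_mem fun A hA hcard => hi (hcard.symm.trans (h A hA))

end Counting

theorem linearIndependent_of_triangular {ι κ K β : Type*} [Ring K] [NoZeroDivisors K] [Preorder β]
    {v : ι → κ → K} {τ : ι → κ} {f : ι → β} (diag : ∀ a, v a (τ a) ≠ 0)
    (lt : ∀ a b, b ≠ a → v b (τ a) ≠ 0 → f a < f b) : LinearIndependent K v := by
  classical
  refine linearIndependent_iff'.2 fun s g hg => ?_
  by_contra! hne
  obtain ⟨c, hc, hgc⟩ := hne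
  obtain ⟨a, ha, hmax⟩ := Finset.exists_maximalFor f {a ∈ s | g a ≠ 0} ⟨c, by simp [hc, hgc]⟩
  rw [Finset.mem_filter] at ha
  have hτ := congrFun hg (τ a)
  rw [Finset.sum_apply, Finset.sum_eq_single_of_mem a ha.1] at hτ
  · exact mul_ne_zero ha.2 (diag a) hτ
  · intro b hb hba
    by_contra hgb
    have hab := lt a b hba (right_ne_zero_of_mul hgb)
    exact hab.not_ge (hmax (by simp [hb, left_ne_zero_of_mul hgb]) hab.le)

/-- If the critical cells of a matching sit in a single degree `i₀`, the ranks `ρ` of the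
differentials are as small as the numbers `u` of matched pairs allow. -/
theorem eq_card_critical_of_concentrated {b ρ x u c : ℕ → ℕ} {i₀ : ℕ}
    (hb : ∀ i, b i + ρ (i + 1) + ρ i = x i) (hx : ∀ i, x i = u i + u (i + 1) + c i)
    (hu : ∀ i, u i ≤ ρ i) (hρ : ρ 0 = 0) (hc : ∀ i, i ≠ i₀ → c i = 0) (i : ℕ) : b i = c i := by
  have heq (j : ℕ) (hj : j ≠ i₀) : ρ j = u j ∧ ρ (j + 1) = u (j + 1) := by
    have := hb j
    have := hx j
    have := hu j
    have := hu (j + 1)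
    have := hc j hj
    omega
  have hρu (j : ℕ) : ρ j = u j := by
    by_cases hj : j = i₀
    · cases j with
      | zero => exact hρ.trans (Nat.le_zero.1 ((hu 0).trans_eq hρ)).symm
      | succ j => exact (heq j (by omega)).2
    · exact (heq j hj).1
  have := hb i
  have := hx i
  have := hρu i
  have := hρu (i + 1)
  omega

section Betti

variable {α β σ K : Type*} [LinearOrder α] [Preorder β] [Field K]
  {𝒞 : Finset (Finset α)} (M : AcyclicMatching 𝒞 β) {m : α → σ →₀ ℕ} {n : ℕ}

/-- The differential modulo the variables, restricted to the sets that contain their pivot, is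
triangular with respect to the weight. -/
theorem card_upper_slice_le_redRank [Fintype α] (h𝒞 : ∀ S, S ∈ 𝒞 ↔ (S.sup m).degree = n) (i : ℕ) :
    #(M.upper.slice i) ≤ (Taylor.resolution K m).redRank n i := by
  have hupper (A : M.upper.slice i) : A.1 ∈ 𝒞 ∧ #A.1 = i ∧ ∃ q ∈ A.1, M.IsPivot A.1 q := by
    obtain ⟨hA, hcard⟩ := Finset.mem_slice.1 A.2
    exact ⟨(mem_upper.1 hA).1, hcard, (mem_upper.1 hA).2⟩
  choose hC hcard q hq hpivot using hupper
  cases i with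
  | zero =>
    refine (Finset.card_eq_zero.2 (Finset.eq_empty_of_forall_notMem fun A hA => ?_)).le
    exact Finset.card_ne_zero_of_mem (hq ⟨A, hA⟩) (hcard ⟨A, hA⟩)
  | succ i =>
    let basis (A : M.upper.slice (i + 1)) : {S // (Taylor.resolution K m).deg (i + 1) S = n} :=
      ⟨⟨A.1, hcard A⟩, (h𝒞 _).1 (hC A)⟩
    let facet (A : M.upper.slice (i + 1)) : {S // (Taylor.resolution K m).deg i S = n} :=
      ⟨⟨A.1.erase (q A), by rw [Finset.card_erase_of_mem (hq A), hcard, Nat.add_sub_cancel]⟩,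
        (h𝒞 _).1 (M.erase (hC A) (hq A) (hpivot A)).1⟩
    have hli : LinearIndependent K fun A : M.upper.slice (i + 1) =>
        (Taylor.resolution K m).redD n i (Pi.single (basis A) 1) := by
      refine linearIndependent_of_triangular (τ := facet) (f := fun A => M.weight A.1 (q A))
        (fun A => ?_) fun A B hBA hne => ?_
      · exact (red_single _ _ _).trans_ne <| Taylor.constantCoeff_d_single_ne_zero m
          (Finset.erase_subset _ _) ((facet A).2.trans (basis A).2.symm)
      · refine M.weight_lt (hq A) (hpivot A) (hq B) (hpivot B) (not_not.1 fun hsub => hne ?_)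
          ((hcard B).trans (hcard A).symm) (Subtype.coe_ne_coe.2 hBA)
        exact (red_single _ _ _).trans <| (congrArg _ (Taylor.d_single_of_not_subset m hsub)).trans
          (map_zero _)
    rw [← Fintype.card_coe, ← finrank_span_eq_card hli]
    exact Submodule.finrank_mono (Submodule.span_le.2 (Set.range_subset_iff.2 fun A => ⟨_, rfl⟩))

theorem betti_eq_card_critical [Finite α] (h𝒞 : ∀ S, S ∈ 𝒞 ↔ (S.sup m).degree = n) {i₀ : ℕ}
    (hcritical : ∀ A ∈ M.critical, #A = i₀)
    (F : MinimalGradedFreeResolution (monomialIdeal K m)) (i : ℕ) :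
    F.betti i n = if i = i₀ then #M.critical else 0 := by
  have := Fintype.ofFinite α
  have hcard (i : ℕ) :
      Fintype.card {S // (Taylor.resolution K m).deg i S = n} = #(𝒞.slice i) :=
    (Fintype.card_congr (Equiv.subtypeSubtypeEquivSubtypeInter (fun S : Finset α => #S = i)
      fun S => (S.sup m).degree = n)).trans <|
      Fintype.card_of_subtype _ fun S => by rw [Finset.mem_slice, h𝒞, and_comm]
  rw [eq_card_critical_of_concentrated (i₀ := i₀) (c := fun i => #(M.critical.slice i))
    (fun i => (F.betti_add_redRank _ (isHomogeneous_monomialIdeal m) i n).trans (hcard i))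
    M.card_slice (M.card_upper_slice_le_redRank h𝒞) rfl
    (fun i hi => by rw [M.slice_critical hcritical, if_neg hi, Finset.card_empty]) i,
    M.slice_critical hcritical]
  split_ifs <;> rfl

end Betti

end AcyclicMatching

/-! ### Covers of a cycle by intervals of equal length -/

namespace CyclicCover

theorem add_le_of_dvd {r a b : ℕ} (ha : r ∣ a) (hb : r ∣ b) (h : a < b) : a + r ≤ b :=
  ((Nat.modEq_zero_iff_dvd.2 ha).trans (Nat.modEq_zero_iff_dvd.2 hb).symm).add_le_of_lt h

/-- The nodes are the integers congruent to `0` or to `-g` modulo `t + 1`. For an unmatched cover of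
a cycle of length `k` with last element `e`, they are the elements of the cover when `g = k - e`. -/
def IsNode (t g x : ℕ) : Prop := t + 1 ∣ x ∨ t + 1 ∣ x + g

section Node

variable {t g x y z : ℕ}

theorem isNode_zero : IsNode t g 0 := Or.inl (dvd_zero _)

theorem IsNode.le_add_of_pos (hx : IsNode t g x) (hpos : 0 < x) : t + 1 ≤ x + g :=
  hx.elim (fun h => (Nat.le_of_dvd hpos h).trans (Nat.le_add_right _ _))
    fun h => Nat.le_of_dvd (by omega) h

theorem IsNode.exists_next (hg : 0 < g) (hgt : g ≤ t) (hx : IsNode t g x) :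
    ∃ y, x < y ∧ y ≤ x + t ∧ IsNode t g y := by
  rcases hx with hx | hx
  · refine ⟨x + (t + 1 - g), by omega, by omega, Or.inr ?_⟩
    rw [add_assoc, Nat.sub_add_cancel (by omega)]
    exact hx.add dvd_rfl
  · exact ⟨x + g, by omega, by omega, Or.inl hx⟩

/-- Two of the three nodes are congruent modulo `t + 1`. -/
theorem IsNode.add_le_of_lt_of_lt (hx : IsNode t g x) (hy : IsNode t g y) (hz : IsNode t g z)
    (hxy : x < y) (hyz : y < z) : x + (t + 1) ≤ z := by
  have hzero {a b : ℕ} (ha : t + 1 ∣ a) (hb : t + 1 ∣ b) (hab : a < b) : a + (t + 1) ≤ b :=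
    add_le_of_dvd ha hb hab
  have hshift {a b : ℕ} (ha : t + 1 ∣ a + g) (hb : t + 1 ∣ b + g) (hab : a < b) :
      a + (t + 1) ≤ b := by
    have := add_le_of_dvd ha hb (by omega)
    omega
  rcases hx with hx | hx <;> rcases hy with hy | hy <;> rcases hz with hz | hz <;>
  first
    | exact (hzero hx hy hxy).trans hyz.le
    | exact (hshift hx hy hxy).trans hyz.le
    | exact hzero hx hz (hxy.trans hyz)
    | exact hshift hx hz (hxy.trans hyz)
    | exact (Nat.add_le_add_right hxy.le _).trans (hzero hy hz hyz)
    | exact (Nat.add_le_add_right hxy.le _).trans (hshift hy hz hyz)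

theorem IsNode.exists_prev (hgt : g ≤ t) (hy : IsNode t g y) (hpos : 0 < y) :
    (∃ x, x + (t + 1) = y ∧ IsNode t g x) ∨ y + g = t + 1 := by
  by_cases hty : t + 1 ≤ y
  · obtain ⟨x, rfl⟩ := Nat.exists_eq_add_of_le' hty
    refine Or.inl ⟨x, rfl, hy.imp (Nat.dvd_add_left dvd_rfl).1 fun h => ?_⟩
    rwa [add_right_comm, Nat.dvd_add_left dvd_rfl] at h
  · refine Or.inr ?_
    rcases hy with hy | hy
    · exact absurd (Nat.le_of_dvd hpos hy) hty
    · refine ((Nat.le_of_dvd (by omega) hy).eq_of_not_lt fun hlt => ?_).symm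
      have := add_le_of_dvd dvd_rfl hy hlt
      omega

end Node

variable {t k : ℕ} {S S' : Finset (Fin k)} {q : Fin k}

/-- `S` covers the cycle of length `k` if every `j < k` lies in one of the cyclic intervals
`{i, …, i + t - 1}` with `i ∈ S`; the second alternative is the case where the interval wraps around
to reach `j + k`. -/
def IsCover (t : ℕ) (S : Finset (Fin k)) : Prop :=
  ∀ j < k, ∃ i ∈ S, (i.1 ≤ j ∧ j < i.1 + t) ∨ j + k < i.1 + t

/-- The largest element of `S`, and `0` if `S` is empty. -/
def last (S : Finset (Fin k)) : ℕ := S.sup Fin.val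

/-- The number of steps from the largest element of `S` to the end of the cycle. -/
def gap (S : Finset (Fin k)) : ℕ := k - last S

theorem le_last {i : Fin k} (h : i ∈ S) : i.1 ≤ last S := Finset.le_sup (f := Fin.val) h

theorem exists_mem_eq_last (h : S.Nonempty) : ∃ i ∈ S, i.1 = last S := by
  obtain ⟨i, hi, h⟩ := Finset.exists_mem_eq_sup S h Fin.val
  exact ⟨i, hi, h.symm⟩

theorem last_mono (h : S ⊆ S') : last S ≤ last S' := Finset.sup_mono h

namespace IsCover

theorem mono (h : IsCover t S) (hS : S ⊆ S') : IsCover t S' := fun j hj =>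
  let ⟨i, hi, hij⟩ := h j hj
  ⟨i, hS hi, hij⟩

theorem exists_eq_last (h : IsCover t S) (hk : 0 < k) : ∃ i ∈ S, i.1 = last S :=
  exists_mem_eq_last (let ⟨i, hi, _⟩ := h 0 hk; ⟨i, hi⟩)

theorem last_lt (h : IsCover t S) (hk : 0 < k) : last S < k := by
  obtain ⟨i, -, hlast⟩ := h.exists_eq_last hk
  exact hlast ▸ i.2

theorem gap_pos (h : IsCover t S) (hk : 0 < k) : 0 < gap S := Nat.sub_pos_of_lt (h.last_lt hk)

theorem gap_le (h : IsCover t S) (hk : 0 < k) : gap S ≤ t := by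
  obtain ⟨i, hi, hcover⟩ := h (k - 1) (by omega)
  have := le_last hi
  unfold gap
  omega

/-- The only element of `S` that can cover the position before the node following `x` is `x`. -/
theorem mem_of_isNode (h : IsCover t S) {x q : Fin k} (hx : IsNode t (gap S) x) (hxq : x < q)
    (hq : IsNode t (gap S) q) (hS : ∀ i ∈ S, i < q → IsNode t (gap S) i) : x ∈ S := by
  have hk : 0 < k := q.pos
  have hgap : gap S + last S = k := Nat.sub_add_cancel (h.last_lt hk).le
  obtain ⟨y, hxy, hyt, hy⟩ := hx.exists_next (h.gap_pos hk) (h.gap_le hk)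
  have hyq : y ≤ q := not_lt.1 fun hqy => by
    have := hx.add_le_of_lt_of_lt hq hy hxq hqy
    omega
  obtain ⟨i, hi, hcover⟩ := h (y - 1) (by omega)
  have hilast := le_last hi
  have hypos := hy.le_add_of_pos (by omega)
  have hi_node := hS i hi (Fin.lt_def.2 (by omega))
  have hix : i = x := by
    rcases lt_trichotomy i x with hlt | heq | hlt
    · have := hi_node.add_le_of_lt_of_lt hx hy hlt hxy
      omega
    · exact heq
    · have := hx.add_le_of_lt_of_lt hi_node hy hlt (by omega)
      omega
  exact hix ▸ hi

end IsCover

/-- `q` is the last node before the first element of `S` that is not a node. -/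
def IsPivot (t : ℕ) (S : Finset (Fin k)) (q : Fin k) : Prop :=
  ∃ s, IsLeast {x | x ∈ S ∧ ¬IsNode t (gap S) x} s ∧
    IsGreatest {x : Fin k | x < s ∧ IsNode t (gap S) x} q

theorem forall_not_isPivot_iff :
    (∀ q, ¬IsPivot t S q) ↔ ∀ i ∈ S, IsNode t (gap S) i := by
  refine ⟨fun h => ?_, fun h q ⟨s, hs, _⟩ => hs.1.2 (h s hs.1.1)⟩
  by_contra! hne
  obtain ⟨s, hs⟩ := (Set.toFinite {x | x ∈ S ∧ ¬IsNode t (gap S) x}).exists_minimal hne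
  rw [minimal_iff_isLeast] at hs
  have hpos : 0 < s.1 := Nat.pos_of_ne_zero fun h0 => hs.1.2 (h0 ▸ isNode_zero)
  obtain ⟨q, hq⟩ := (Set.toFinite {x : Fin k | x < s ∧ IsNode t (gap S) x}).exists_maximal
    ⟨⟨0, s.pos⟩, hpos, isNode_zero⟩
  exact h q ⟨s, hs, maximal_iff_isGreatest.1 hq⟩

namespace IsPivot

theorem unique {q' : Fin k} (h : IsPivot t S q) (h' : IsPivot t S q') : q = q' := by
  obtain ⟨s, hs, hq⟩ := h
  obtain ⟨s', hs', hq'⟩ := h'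
  obtain rfl := hs.unique hs'
  exact hq.unique hq'

theorem last_lt (h : IsPivot t S q) : q.1 < last S := by
  obtain ⟨s, hs, hq⟩ := h
  exact (Fin.lt_def.1 hq.1.1).trans_le (le_last hs.1.1)

theorem last_erase (h : IsPivot t S q) : last (S.erase q) = last S := by
  refine (last_mono (S.erase_subset q)).antisymm ?_
  obtain ⟨s, hs, hq⟩ := h
  obtain ⟨i, hi, hlast⟩ := exists_mem_eq_last ⟨s, hs.1.1⟩
  rw [← hlast]
  refine le_last (Finset.mem_erase.2 ⟨?_, hi⟩)
  rintro rfl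
  exact absurd (le_last hs.1.1) (by rw [← hlast]; exact hq.1.1.not_ge)

theorem last_insert (h : IsPivot t S q) : last (insert q S) = last S := by
  rw [last, Finset.sup_insert]
  exact sup_eq_right.2 h.last_lt.le

theorem congr (h : IsPivot t S q) (hlast : last S' = last S) (hS : S'.erase q = S.erase q) :
    IsPivot t S' q := by
  have hgap : gap S' = gap S := congrArg (k - ·) hlast
  obtain ⟨s, hs, hq⟩ := h
  have hmem (x : Fin k) (hx : ¬IsNode t (gap S) x) : x ∈ S' ↔ x ∈ S := by
    have hxq : x ≠ q := fun h => hx (h ▸ hq.1.2)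
    simpa only [Finset.mem_erase, ne_eq, hxq, not_false_eq_true, true_and]
      using Finset.ext_iff.1 hS x
  refine ⟨s, ?_, by rwa [hgap]⟩
  rwa [hgap, show {x | x ∈ S' ∧ ¬IsNode t (gap S) x} = {x | x ∈ S ∧ ¬IsNode t (gap S) x} from
    Set.ext fun x => and_congr_left (hmem x)]

theorem erase (h : IsPivot t S q) : IsPivot t (S.erase q) q := h.congr h.last_erase (by simp)

theorem insert (h : IsPivot t S q) : IsPivot t (insert q S) q := h.congr h.last_insert (by simp)

end IsPivot

theorem IsCover.erase_isPivot (h : IsCover t S) (hq : IsPivot t S q) : IsCover t (S.erase q) := by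
  have hk : 0 < k := q.pos
  have hgap : gap S + last S = k := Nat.sub_add_cancel (h.last_lt hk).le
  have hgap_le := h.gap_le hk
  have hqlast := hq.last_lt
  obtain ⟨e, he, helast⟩ := h.exists_eq_last hk
  have heq : e ∈ S.erase q := Finset.mem_erase.2 ⟨by rintro rfl; omega, he⟩
  obtain ⟨s, hs, hq⟩ := hq
  have hqs : q.1 < s.1 := hq.1.1
  have hS (i) (hi : i ∈ S) (hiq : i < q) : IsNode t (gap S) i :=
    not_not.1 fun hn => (hiq.trans hq.1.1).not_ge (hs.2 ⟨hi, hn⟩)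
  obtain ⟨y, hqy, hyt, hy⟩ := hq.1.2.exists_next (h.gap_pos hk) hgap_le
  have hsy : s.1 < y := by
    refine lt_of_le_of_ne (not_lt.1 fun hys => ?_) fun hsy => hs.1.2 (hsy ▸ hy)
    exact absurd (hq.2 (show ⟨y, hys.trans s.2⟩ ∈ _ from ⟨hys, hy⟩)) hqy.not_ge
  intro j hj
  obtain ⟨i, hi, hcover⟩ := h j hj
  by_cases hiq : i ≠ q
  · exact ⟨i, Finset.mem_erase.2 ⟨hiq, hi⟩, hcover⟩
  obtain rfl : i = q := not_not.1 hiq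
  rcases hcover with ⟨hqj, hjq⟩ | hwrap
  swap
  · exact ⟨e, heq, by omega⟩
  by_cases hjs : s.1 ≤ j
  · exact ⟨s, Finset.mem_erase.2 ⟨hq.1.1.ne', hs.1.1⟩, by omega⟩
  -- Positions before `s` are covered by the node preceding `y`, cyclically.
  rcases hy.exists_prev hgap_le (by omega) with ⟨x, hxy, hx⟩ | hyg
  · have hxS := h.mem_of_isNode (x := ⟨x, by omega⟩) hx (Fin.lt_def.2 (by simp only; omega))
      hq.1.2 hS
    exact ⟨⟨x, _⟩, Finset.mem_erase.2 ⟨Fin.ne_of_lt (Fin.lt_def.2 (by simp only; omega)), hxS⟩,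
      by simp only; omega⟩
  · exact ⟨e, heq, by omega⟩

open Classical in
/-- The covers of a cycle of length `k` by intervals of length `t`. -/
noncomputable def covers (t k : ℕ) : Finset (Finset (Fin k)) := {S | IsCover t S}

theorem mem_covers : S ∈ covers t k ↔ IsCover t S := by simp [covers]

theorem toLex_last_lt_of_isPivot {q' : Fin k} (hqS : q ∈ S) (hq : IsPivot t S q) (hqS' : q' ∈ S')
    (hq' : IsPivot t S' q') (hsub : S.erase q ⊆ S') (hcard : #S' = #S) (hne : S' ≠ S) :
    toLex (last S, OrderDual.toDual q) < toLex (last S', OrderDual.toDual q') := by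
  refine Prod.Lex.toLex_lt_toLex.2 ?_
  rcases (hq.last_erase.ge.trans (last_mono hsub)).lt_or_eq with hlt | heq
  · exact Or.inl hlt
  refine Or.inr ⟨heq, OrderDual.toDual_lt_toDual.2 (lt_of_le_of_ne ?_ ?_)⟩
  · obtain ⟨s, hs, hq⟩ := hq
    obtain ⟨s', hs', hq'⟩ := hq'
    have hgap : gap S' = gap S := congrArg (k - ·) heq.symm
    rw [hgap] at hs' hq'
    have hss : s' ≤ s := hs'.2 ⟨hsub (Finset.mem_erase.2 ⟨hq.1.1.ne', hs.1.1⟩), hs.1.2⟩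
    exact hq.2 ⟨hq'.1.1.trans_le hss, hq'.1.2⟩
  · rintro rfl
    refine hne (Finset.eq_of_subset_of_card_le ?_ hcard.le).symm
    exact Finset.insert_erase hqS ▸ Finset.insert_subset hqS' hsub

/-- The acyclic matching of the covers whose unmatched covers consist of nodes. -/
noncomputable def matching (t k : ℕ) : AcyclicMatching (covers t k) (ℕ ×ₗ (Fin k)ᵒᵈ) where
  IsPivot := IsPivot t
  unique := IsPivot.unique
  erase hS _ hq := ⟨mem_covers.2 ((mem_covers.1 hS).erase_isPivot hq), hq.erase⟩
  insert hS _ hq := ⟨mem_covers.2 ((mem_covers.1 hS).mono (Finset.subset_insert _ _)), hq.insert⟩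
  weight S q := toLex (last S, OrderDual.toDual q)
  weight_lt := toLex_last_lt_of_isPivot

theorem mem_critical : S ∈ (matching t k).critical ↔ IsCover t S ∧ ∀ i ∈ S, IsNode t (gap S) i :=
  AcyclicMatching.mem_critical.trans (and_congr mem_covers forall_not_isPivot_iff)

open Classical in
/-- The nodes up to `e` on a cycle of length `k`. -/
noncomputable def nodes (t k e : ℕ) : Finset (Fin k) := {x | x.1 ≤ e ∧ IsNode t (k - e) x}

open Classical in
/-- The possible last elements of the unmatched covers. -/
noncomputable def ends (t k : ℕ) : Finset ℕ := {e ∈ Finset.range k | k ≤ e + t ∧ IsNode t (k - e) e}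

theorem mem_nodes {e : ℕ} {x : Fin k} : x ∈ nodes t k e ↔ x.1 ≤ e ∧ IsNode t (k - e) x := by
  simp [nodes]

theorem mem_ends {e : ℕ} : e ∈ ends t k ↔ e < k ∧ k ≤ e + t ∧ IsNode t (k - e) e := by
  simp [ends]

theorem last_nodes {e : ℕ} (he : e ∈ ends t k) : last (nodes t k e) = e := by
  obtain ⟨hek, -, hnode⟩ := mem_ends.1 he
  exact (Finset.sup_le fun i hi => (mem_nodes.1 hi).1).antisymm
    (le_last (i := ⟨e, hek⟩) (mem_nodes.2 ⟨le_rfl, hnode⟩))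

theorem isCover_nodes {e : ℕ} (he : e ∈ ends t k) : IsCover t (nodes t k e) := by
  obtain ⟨hek, hket, hnode⟩ := mem_ends.1 he
  intro j hj
  rcases le_or_gt e j with hej | hje
  · exact ⟨⟨e, hek⟩, mem_nodes.2 ⟨le_rfl, hnode⟩, Or.inl ⟨hej, by simp only; omega⟩⟩
  obtain ⟨x, ⟨hxj, hx⟩, hmax⟩ := BddAbove.exists_isGreatest_of_nonempty
    (S := {x | x ≤ j ∧ IsNode t (k - e) x}) ⟨j, fun _ hx => hx.1⟩ ⟨0, j.zero_le, isNode_zero⟩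
  obtain ⟨y, hxy, hyt, hy⟩ := hx.exists_next (by omega) (by omega)
  have hjy : j < y := not_le.1 fun hyj => hxy.not_ge (hmax ⟨hyj, hy⟩)
  exact ⟨⟨x, by omega⟩, mem_nodes.2 ⟨hxj.trans hje.le, hx⟩, Or.inl ⟨hxj, by simp only; omega⟩⟩

theorem mem_critical_iff_exists (hk : 0 < k) :
    S ∈ (matching t k).critical ↔ ∃ e ∈ ends t k, nodes t k e = S := by
  refine mem_critical.trans ⟨fun ⟨hcover, hnodes⟩ => ?_, ?_⟩
  · obtain ⟨e, he, helast⟩ := hcover.exists_eq_last hk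
    have hlt := hcover.last_lt hk
    have hle := hcover.gap_le hk
    have hlast_node : IsNode t (gap S) (last S) := helast ▸ hnodes e he
    refine ⟨last S, mem_ends.2 ⟨hlt, Nat.sub_le_iff_le_add'.1 hle, hlast_node⟩, ?_⟩
    ext x
    refine mem_nodes.trans ⟨fun ⟨hxe, hx⟩ => ?_, fun hx => ⟨le_last hx, hnodes x hx⟩⟩
    rcases (hxe.trans_eq helast.symm).lt_or_eq with hlt | heq
    · exact hcover.mem_of_isNode hx hlt (hnodes e he) fun i hi _ => hnodes i hi
    · exact Fin.ext heq ▸ he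
  · rintro ⟨e, he, rfl⟩
    refine ⟨isCover_nodes he, fun i hi => ?_⟩
    rw [gap, last_nodes he]
    exact (mem_nodes.1 hi).2

open Classical in
theorem critical_eq_image (hk : 0 < k) :
    (matching t k).critical = (ends t k).image (nodes t k) :=
  Finset.ext fun _ => (mem_critical_iff_exists hk).trans Finset.mem_image.symm

theorem card_critical_eq_card_ends (hk : 0 < k) : #(matching t k).critical = #(ends t k) := by
  classical
  rw [critical_eq_image hk]
  exact Finset.card_image_of_injOn fun e he e' he' h => by
    rw [← last_nodes he, ← last_nodes he', h]

theorem card_filter_range_dvd (r e : ℕ) : #{x ∈ Finset.range (e + 1) | r ∣ x} = e / r + 1 := by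
  rw [Nat.range_succ_eq_Icc_zero, ← Finset.Ioc_insert_left e.zero_le,
    Finset.filter_insert, if_pos (dvd_zero _), Finset.card_insert_of_notMem (by simp),
    Nat.Ioc_filter_dvd_card_eq_div]

theorem card_filter_range_dvd_add {r e g : ℕ} (hg : 0 < g) (hgr : g < r) :
    #{x ∈ Finset.range (e + 1) | r ∣ x + g} = (e + g) / r := by
  rw [← Nat.Ioc_filter_dvd_card_eq_div, ← Finset.card_map (addRightEmbedding g)]
  congr 1
  ext y
  simp only [Finset.mem_map, Finset.mem_filter, Finset.mem_range, Finset.mem_Ioc,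
    addRightEmbedding_apply]
  constructor
  · rintro ⟨x, ⟨hx, hdvd⟩, rfl⟩
    exact ⟨by omega, hdvd⟩
  · rintro ⟨hy, hdvd⟩
    have := Nat.le_of_dvd hy.1 hdvd
    exact ⟨y - g, ⟨by omega, by rwa [Nat.sub_add_cancel (by omega)]⟩, by omega⟩

/-- The multiples of `t + 1` and the translated multiples are counted separately. -/
theorem card_nodes {e : ℕ} (hek : e < k) (hket : k ≤ e + t) :
    #(nodes t k e) = e / (t + 1) + 1 + k / (t + 1) := by
  have hdisj : Disjoint {x ∈ Finset.range (e + 1) | t + 1 ∣ x}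
      {x ∈ Finset.range (e + 1) | t + 1 ∣ x + (k - e)} := by
    refine Finset.disjoint_filter.2 fun x _ hx hx' => ?_
    have := Nat.le_of_dvd (by omega) ((Nat.dvd_add_right hx).1 hx')
    omega
  have hmap : (nodes t k e).map Fin.valEmbedding = {x ∈ Finset.range (e + 1) | t + 1 ∣ x}.disjUnion
      {x ∈ Finset.range (e + 1) | t + 1 ∣ x + (k - e)} hdisj := by
    ext x
    simp only [Finset.mem_map, mem_nodes, Finset.mem_disjUnion, Finset.mem_filter,
      Finset.mem_range_succ_iff, Fin.valEmbedding_apply, ← and_or_left]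
    exact ⟨fun ⟨_, hy, hyx⟩ => hyx ▸ hy, fun hx => ⟨⟨x, by omega⟩, hx, rfl⟩⟩
  rw [← Finset.card_map Fin.valEmbedding, hmap, Finset.card_disjUnion, card_filter_range_dvd,
    card_filter_range_dvd_add (by omega) (by omega), Nat.add_sub_cancel' hek.le]

section Count

variable {p d : ℕ}

theorem ends_eq_Ico (hkp : k = p * (t + 1)) : ends t k = Finset.Ico (k - t) k := by
  ext e
  have hnode : e < k → IsNode t (k - e) e := fun hek =>
    Or.inr (by rw [Nat.add_sub_cancel' hek.le, hkp]; exact dvd_mul_left _ _)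
  rw [mem_ends, Finset.mem_Ico]
  grind

theorem ends_eq_singleton (hkp : k = p * (t + 1) + d) (hd : d ≤ t) (hd0 : d ≠ 0) :
    ends t k = {p * (t + 1)} := by
  ext e
  have hdvd : ¬t + 1 ∣ k := by
    rw [hkp, Nat.dvd_add_right (dvd_mul_left _ _)]
    exact Nat.not_dvd_of_pos_of_lt (Nat.pos_of_ne_zero hd0) (by omega)
  rw [mem_ends, Finset.mem_singleton]
  constructor
  · rintro ⟨hek, hket, he | he⟩
    · rcases lt_trichotomy e (p * (t + 1)) with hlt | heq | hlt
      · have := add_le_of_dvd he (dvd_mul_left _ p) hlt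
        omega
      · exact heq
      · have := add_le_of_dvd (dvd_mul_left _ p) he hlt
        omega
    · exact absurd he (by rwa [Nat.add_sub_cancel' hek.le])
  · rintro rfl
    exact ⟨by omega, by omega, Or.inl (dvd_mul_left _ _)⟩

theorem card_critical (hk : 0 < k) (hkp : k = p * (t + 1) + d) (hd : d ≤ t) :
    #(matching t k).critical = if d = 0 then t else 1 := by
  rw [card_critical_eq_card_ends hk]
  split_ifs with hd0
  · subst hd0
    have hp : p ≠ 0 := by rintro rfl; omega
    have := Nat.le_mul_of_pos_left (t + 1) (Nat.pos_of_ne_zero hp)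
    rw [ends_eq_Ico hkp, Nat.card_Ico]
    omega
  · rw [ends_eq_singleton hkp hd hd0, Finset.card_singleton]

theorem card_of_mem_critical (hk : 0 < k) (hkp : k = p * (t + 1) + d) (hd : d ≤ t)
    (hS : S ∈ (matching t k).critical) : #S = if d = 0 then 2 * p else 2 * p + 1 := by
  obtain ⟨e, he, rfl⟩ := (mem_critical_iff_exists hk).1 hS
  have hquot : k / (t + 1) = p := by
    rw [hkp, mul_comm, Nat.mul_add_div (by omega), Nat.div_eq_of_lt (by omega), add_zero]
  obtain ⟨hek, hket, -⟩ := mem_ends.1 he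
  rw [card_nodes hek hket, hquot]
  split_ifs with hd0
  · have hp : p - 1 + 1 = p := Nat.sub_add_cancel (Nat.pos_of_ne_zero (by rintro rfl; omega))
    have hmul := congrArg (· * (t + 1)) hp
    simp only [Nat.add_mul] at hmul
    rw [Nat.div_eq_of_lt_le (k := p - 1) (by omega) (by rw [hp]; omega), hp, two_mul]
  · rw [ends_eq_singleton hkp hd hd0, Finset.mem_singleton] at he
    rw [he, Nat.mul_div_cancel _ (by omega)]
    omega

end Count

end CyclicCover

/-! ### Existence of minimal graded free resolutions -/

theorem exists_minimal_generators {R M : Type*} [Ring R] [AddCommGroup M] [Module R M]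
    {S : Set M} (hS : (Submodule.span R S).FG) :
    ∃ (r : ℕ) (g : Fin r → M), (∀ a, g a ∈ S) ∧
      Submodule.span R (Set.range g) = Submodule.span R S ∧
      ∀ a, g a ∉ Submodule.span R (g '' {a}ᶜ) := by
  classical
  obtain ⟨T₀, hT₀S, hT₀⟩ := (Submodule.fg_span_iff_fg_span_finset_subset S).1 hS
  obtain ⟨T, ⟨hTS, hT⟩, hmin⟩ := exists_minimal_of_wellFoundedLT
    (fun T : Finset M => ↑T ⊆ S ∧ Submodule.span R (T : Set M) = Submodule.span R S)
    ⟨T₀, hT₀S, hT₀.symm⟩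
  have hrange : Set.range (fun a => (T.equivFin.symm a : M)) = T :=
    (T.equivFin.symm.surjective.range_comp _).trans Subtype.range_coe
  refine ⟨#T, fun a => T.equivFin.symm a, fun a => hTS (T.equivFin.symm a).2, by rw [hrange, hT],
    fun a ha => ?_⟩
  set x : M := (T.equivFin.symm a).1
  have himage : (fun a => (T.equivFin.symm a : M)) '' {a}ᶜ ⊆ ↑(T.erase x) := by
    rintro _ ⟨b, hb, rfl⟩
    rw [Finset.coe_erase]
    exact ⟨(T.equivFin.symm b).2, fun h => hb (T.equivFin.symm.injective (Subtype.ext h))⟩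
  have hspan : Submodule.span R (T.erase x : Set M) = Submodule.span R S := by
    rw [← hT, ← Submodule.span_insert_eq_span (Submodule.span_mono himage ha), ← Finset.coe_insert,
      Finset.insert_erase (T.equivFin.symm a).2]
  exact Finset.notMem_erase x T (hmin ⟨fun _ hy => hTS (Finset.mem_of_mem_erase hy), hspan⟩
    (Finset.erase_subset x T) (T.equivFin.symm a).2)

/-- A graded submodule of a graded free module of finite rank. -/
structure GradedSubmodule (σ K : Type*) [Field K] where
  /-- the rank of the free module -/
  rank : ℕ
  /-- the degrees of the basis elements -/
  deg : Fin rank → ℕ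
  /-- the submodule -/
  toSubmodule : Submodule (MvPolynomial σ K) (Fin rank → MvPolynomial σ K)
  component_mem : ∀ v ∈ toSubmodule, ∀ j, component deg j v ∈ toSubmodule

namespace GradedSubmodule

variable {σ K : Type*} [Field K]

/-- An ideal is a graded submodule of the free module of rank one generated in degree `0`. -/
noncomputable def ofIdeal {I : Ideal (MvPolynomial σ K)}
    (hI : I.IsHomogeneous (homogeneousSubmodule σ K)) : GradedSubmodule σ K where
  rank := 1
  deg _ := 0
  toSubmodule := Submodule.comap (LinearMap.proj 0) I
  component_mem v hv j := by
    simpa [component] using homogeneousComponent_mem_of_mem hI hv j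

theorem exists_augmentation {I : Ideal (MvPolynomial σ K)}
    (hI : I.IsHomogeneous (homogeneousSubmodule σ K)) :
    ∃ aug : (Fin (ofIdeal hI).rank → MvPolynomial σ K) →ₗ[MvPolynomial σ K] MvPolynomial σ K ⧸ I,
      (∀ j, ∀ v ∈ gradedFreePiece (ofIdeal hI).deg j,
        ∃ f : MvPolynomial σ K, f.IsHomogeneous j ∧ aug v = Ideal.Quotient.mk I f) ∧
      Function.Surjective aug ∧ LinearMap.ker aug = (ofIdeal hI).toSubmodule := by
  refine ⟨I.mkQ ∘ₗ LinearMap.proj (0 : Fin 1), fun j v hv => ⟨v (0 : Fin 1), fun e he => ?_, rfl⟩,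
    I.mkQ_surjective.comp (LinearMap.proj_surjective _), ?_⟩
  · rw [← mem_gradedFreePiece.1 hv (0 : Fin 1) e he, Finsupp.degree_eq_weight_one]
    rfl
  · ext v
    exact Submodule.Quotient.mk_eq_zero I

/-- The kernel of a graded map. -/
noncomputable def ker {r r' : ℕ} {deg : Fin r → ℕ} {deg' : Fin r' → ℕ}
    {f : FreeMap σ K (Fin r) (Fin r')} (hf : IsGraded deg deg' f) : GradedSubmodule σ K where
  rank := r
  deg := deg
  toSubmodule := LinearMap.ker f
  component_mem v hv j := by
    rw [LinearMap.mem_ker] at hv ⊢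
    rw [hf.map_component, hv, map_zero]

theorem span_homogeneous_eq (N : GradedSubmodule σ K) :
    Submodule.span (MvPolynomial σ K) {v ∈ N.toSubmodule | ∃ j, v ∈ gradedFreePiece N.deg j} =
      N.toSubmodule := by
  refine le_antisymm (Submodule.span_le.2 fun v hv => hv.1) fun v hv => ?_
  obtain ⟨n, hn⟩ := (eventually_sum_component_eq N.deg v).exists
  rw [← hn]
  exact Submodule.sum_mem _ fun j _ =>
    Submodule.subset_span ⟨N.component_mem v hv j, j, GradedFree.component_mem _ _ _⟩

/-- The coefficient of a basis element in a graded relation in its own degree is a constant. -/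
theorem constantCoeff_eq_zero_of_notMem_span {r r' : ℕ} {deg : Fin r → ℕ} {deg' : Fin r' → ℕ}
    {f : FreeMap σ K (Fin r) (Fin r')} (hf : IsGraded deg deg' f) {a : Fin r}
    (ha : f (Pi.single a 1) ∉
      Submodule.span (MvPolynomial σ K) ((fun b => f (Pi.single b 1)) '' {a}ᶜ))
    {v : Fin r → MvPolynomial σ K} (hv : f v = 0) : constantCoeff (v a) = 0 := by
  contrapose! ha
  set w := component deg (deg a) v
  have hw : f w = 0 := by rw [hf.map_component, hv, map_zero]
  have hwa : w a = C (constantCoeff (v a)) := by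
    ext e
    classical
    rw [coeff_component, coeff_C, constantCoeff_eq]
    simp only [Nat.add_eq_right, Finsupp.degree_eq_zero_iff, eq_comm (a := (0 : σ →₀ ℕ))]
    exact if_ctx_congr Iff.rfl (fun he => by rw [he]) fun _ => rfl
  rw [eq_sum_smul_single w, map_sum, ← Finset.add_sum_erase _ _ (Finset.mem_univ a),
    add_eq_zero_iff_eq_neg, map_smul, hwa] at hw
  rw [← Submodule.smul_mem_iff_of_isUnit _ ((isUnit_iff_ne_zero.2 ha).map C), hw]
  refine Submodule.neg_mem _ (Submodule.sum_mem _ fun b hb => ?_)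
  rw [map_smul]
  exact Submodule.smul_mem _ _ (Submodule.subset_span ⟨b, Finset.ne_of_mem_erase hb, rfl⟩)

theorem exists_minimal_cover [Finite σ] (N : GradedSubmodule σ K) :
    ∃ (r : ℕ) (deg : Fin r → ℕ) (f : FreeMap σ K (Fin r) (Fin N.rank)),
      IsGraded deg N.deg f ∧ LinearMap.range f = N.toSubmodule ∧
        ∀ v ∈ LinearMap.ker f, ∀ a, constantCoeff (v a) = 0 := by
  obtain ⟨r, g, hg, hspan, hmin⟩ := exists_minimal_generators (R := MvPolynomial σ K)
    (S := {v ∈ N.toSubmodule | ∃ j, v ∈ gradedFreePiece N.deg j}) (IsNoetherian.noetherian _)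
  choose deg hdeg using fun a => (hg a).2
  obtain ⟨f, hfg⟩ := exists_map_single_eq (σ := σ) (K := K) g
  obtain rfl : (fun a => f (Pi.single a 1)) = g := _root_.funext hfg
  have hf : IsGraded deg N.deg f := isGraded_of_basis hdeg
  refine ⟨r, deg, f, hf, ?_, fun v hv a => constantCoeff_eq_zero_of_notMem_span hf (hmin a) hv⟩
  rw [← N.span_homogeneous_eq, ← hspan, LinearMap.range_eq_map, ← (Pi.basisFun _ _).span_eq,
    Submodule.map_span, ← Set.range_comp]
  simp [Function.comp_def]

end GradedSubmodule

namespace MinimalGradedFreeResolution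

variable {σ K : Type*} [Field K]

theorem nonempty_of_isHomogeneous [Finite σ] {I : Ideal (MvPolynomial σ K)}
    (hI : I.IsHomogeneous (homogeneousSubmodule σ K))
    (hI𝔪 : I ≤ Ideal.span (Set.range (X : σ → MvPolynomial σ K))) :
    Nonempty (MinimalGradedFreeResolution I) := by
  obtain ⟨N, hN₀, hN𝔪, hN⟩ := exists_seq_of_forall_exists_succ
    (α := fun _ => GradedSubmodule σ K)
    (P := fun _ N => ∀ v ∈ N.toSubmodule, ∀ a, constantCoeff (v a) = 0)
    (r := fun _ N N' => ∃ f : FreeMap σ K (Fin N'.rank) (Fin N.rank), IsGraded N'.deg N.deg f ∧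
      LinearMap.range f = N.toSubmodule ∧ LinearMap.ker f = N'.toSubmodule)
    (x₀ := .ofIdeal hI)
    (fun v hv a => (Subsingleton.elim (0 : Fin 1) a) ▸ mem_span_range_X_iff.1 (hI𝔪 hv))
    fun _ N _ => by
      obtain ⟨r, deg, f, hf, hrange, hker⟩ := N.exists_minimal_cover
      exact ⟨.ker hf, hker, f, hf, hrange, rfl⟩
  choose d hd hrange hker using hN
  have haug := GradedSubmodule.exists_augmentation hI
  rw [← hN₀] at haug
  obtain ⟨aug, haug, hsurj, haug_ker⟩ := haug
  exact ⟨{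
    rank i := (N i).rank
    deg i := (N i).deg
    d := d
    aug := aug
    d_graded := hd
    aug_graded := haug
    aug_surjective := hsurj
    exact_zero := LinearMap.exact_iff.2 (haug_ker.trans (hrange 0).symm)
    exact_succ i := LinearMap.exact_iff.2 ((hker i).trans (hrange (i + 1)).symm)
    minimal i v a := mem_span_range_X_iff.2 (hN𝔪 i _ (hrange i ▸ ⟨v, rfl⟩) a) }⟩

end MinimalGradedFreeResolution

/-! ### Path ideals of cycles -/

/-- The exponent vector of the squarefree monomial with support `A`. -/
noncomputable def squarefreeExponent {σ : Type*} (A : Finset σ) : σ →₀ ℕ :=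
  ∑ v ∈ A, Finsupp.single v 1

section Squarefree

variable {σ : Type*}

theorem squarefreeExponent_apply [DecidableEq σ] (A : Finset σ) (v : σ) :
    squarefreeExponent A v = if v ∈ A then 1 else 0 := by
  simp [squarefreeExponent, Finsupp.single_apply]

theorem degree_squarefreeExponent (A : Finset σ) : (squarefreeExponent A).degree = #A := by
  simp [squarefreeExponent]

theorem sup_squarefreeExponent [DecidableEq σ] {α : Type*} (S : Finset α) (A : α → Finset σ) :
    (S.sup fun i => squarefreeExponent (A i)) = squarefreeExponent (S.sup A) := by
  refine (Finset.apply_sup_eq_sup_comp squarefreeExponent (fun A B => ?_) rfl).symm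
  ext v
  simp only [Finsupp.sup_apply, squarefreeExponent_apply, Finset.sup_eq_union, Finset.mem_union]
  grind

theorem degree_sup_squarefreeExponent_eq_card_iff [Fintype σ] {α : Type*} (S : Finset α)
    (A : α → Finset σ) :
    (S.sup fun i => squarefreeExponent (A i)).degree = Fintype.card σ ↔ ∀ v, ∃ i ∈ S, v ∈ A i := by
  classical
  rw [sup_squarefreeExponent, degree_squarefreeExponent, Finset.card_eq_iff_eq_univ,
    Finset.eq_univ_iff_forall]
  simp only [Finset.mem_sup]

end Squarefree

namespace CyclePath

/-- The `i`-th path, which consists of the `m` vertices of the `n`-cycle that follow `i * l`. -/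
def vertices (m l n i : ℕ) : Finset (ZMod n) :=
  (Finset.Icc 1 m).image fun j => ((i * l + j : ℕ) : ZMod n)

variable {m l n k s t : ℕ}

theorem monomial_squarefreeExponent_vertices (K : Type*) [Field K] (hmn : m ≤ n) (i : ℕ) :
    monomial (squarefreeExponent (vertices m l n i)) (1 : K) =
      ∏ j ∈ Finset.Icc 1 m, X ((i * l + j : ℕ) : ZMod n) := by
  rw [squarefreeExponent, monomial_sum_one, vertices, Finset.prod_image]
  · rfl
  · intro a ha b hb hab
    rw [Finset.coe_Icc, Set.mem_Icc] at ha hb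
    have hmod : a - 1 ≡ b - 1 [MOD n] := by
      refine Nat.ModEq.add_left_cancel' (i * l + 1) ?_
      convert (ZMod.natCast_eq_natCast_iff _ _ _).1 hab using 1 <;> omega
    have := hmod.eq_of_lt_of_lt (by omega) (by omega)
    omega

theorem cyclePathIdeal_eq_monomialIdeal (K : Type*) [Field K] (hmn : m ≤ n) (hln : l ∣ n) :
    cyclePathIdeal K m l n =
      monomialIdeal K fun i : Fin (n / l) => squarefreeExponent (vertices m l n i) := by
  rw [cyclePathIdeal, monomialIdeal, Nat.gcd_eq_left hln]
  simp only [monomial_squarefreeExponent_vertices K hmn]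
  congr 1
  ext u
  constructor
  · rintro ⟨i, hi, rfl⟩
    rw [Finset.mem_Icc] at hi
    exact ⟨⟨i - 1, by omega⟩, rfl⟩
  · rintro ⟨i, rfl⟩
    exact ⟨i + 1, Finset.mem_Icc.2 ⟨by omega, i.2⟩, rfl⟩

theorem mem_vertices_iff {i a : ℕ} (hmn : m ≤ n) (hi : i * l ≤ n) (ha : a < n) :
    ((a + 1 : ℕ) : ZMod n) ∈ vertices m l n i ↔
      (i * l ≤ a ∧ a < i * l + m) ∨ a + n < i * l + m := by
  simp only [vertices, Finset.mem_image, Finset.mem_Icc, ZMod.natCast_eq_natCast_iff]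
  constructor
  · rintro ⟨j, hj, h⟩
    obtain ⟨j, rfl⟩ := Nat.exists_eq_add_of_le' hj.1
    replace h : i * l + j ≡ a [MOD n] := Nat.ModEq.add_right_cancel' 1 h
    rcases lt_or_ge (i * l + j) n with hlt | hge
    · have := h.eq_of_lt_of_lt hlt ha
      omega
    · have hsub : i * l + j - n ≡ a [MOD n] := by
        rw [← Nat.sub_add_cancel hge] at h
        exact Nat.add_modEq_right.symm.trans h
      have := hsub.eq_of_lt_of_lt (by omega) ha
      omega
  · rintro (h | h)
    · exact ⟨a + 1 - i * l, by omega, by rw [Nat.add_sub_cancel' (by omega)]⟩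
    · refine ⟨a + 1 + n - i * l, by omega, ?_⟩
      rw [Nat.add_sub_cancel' (by omega)]
      exact Nat.add_modEq_right

theorem isCover_iff (hn : n = k * l) (hs : s < l) (S : Finset (Fin k)) :
    CyclicCover.IsCover t S ↔ ∀ a < n, ∃ i ∈ S,
      (i.1 * l ≤ a ∧ a < i.1 * l + (t * l + s)) ∨ a + n < i.1 * l + (t * l + s) := by
  have hmul {x y : ℕ} (h : x ≤ y) : x * l ≤ y * l := Nat.mul_le_mul_right l h
  constructor
  · intro h a ha
    have hl : 0 < l := by omega
    obtain ⟨i, hi, h⟩ := h (a / l) (Nat.div_lt_of_lt_mul (by rwa [mul_comm, ← hn]))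
    have hdiv := Nat.div_mul_le_self a l
    have hmod := Nat.lt_div_mul_add hl (a := a)
    refine ⟨i, hi, h.imp (fun h => ⟨(hmul h.1).trans hdiv, ?_⟩) fun h => ?_⟩
    · have := hmul h.2
      rw [Nat.succ_mul, Nat.add_mul] at this
      omega
    · have := hmul h
      rw [Nat.succ_mul, Nat.add_mul, Nat.add_mul] at this
      omega
  · -- The last position of the `j`-th block forces the whole block to lie on the path.
    intro h j hj
    have hjn : j * l + l ≤ n := by
      rw [hn, ← Nat.succ_mul]
      exact hmul hj
    obtain ⟨i, hi, h⟩ := h (j * l + (l - 1)) (by omega)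
    refine ⟨i, hi, h.imp (fun h => ⟨?_, ?_⟩) fun h => ?_⟩ <;> by_contra! hlt <;>
      have hlt := hmul hlt <;> simp only [Nat.succ_mul, Nat.add_mul] at hlt <;> omega

theorem degree_sup_eq_iff_isCover [NeZero n] (hmn : m ≤ n) (hn : n = k * l) (hs : s < l)
    (hmt : m = t * l + s) (S : Finset (Fin k)) :
    (S.sup fun i => squarefreeExponent (vertices m l n i)).degree = n ↔
      CyclicCover.IsCover t S := by
  have hdegree := degree_sup_squarefreeExponent_eq_card_iff S fun i : Fin k => vertices m l n i
  rw [ZMod.card] at hdegree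
  have hpos (i : Fin k) : i * l ≤ n := hn ▸ Nat.mul_le_mul_right l i.2.le
  rw [hdegree, isCover_iff hn hs, ← hmt]
  refine ⟨fun h a ha => ?_, fun h v => ?_⟩
  · obtain ⟨i, hi, hmem⟩ := h ((a + 1 : ℕ) : ZMod n)
    exact ⟨i, hi, (mem_vertices_iff hmn (hpos i) ha).1 hmem⟩
  · obtain ⟨i, hi, hmem⟩ := h (v - 1).val (v - 1).val_lt
    refine ⟨i, hi, ?_⟩
    rwa [← mem_vertices_iff hmn (hpos i) (v - 1).val_lt, Nat.cast_succ, ZMod.natCast_zmod_val,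
      sub_add_cancel] at hmem

end CyclePath

theorem theorem5p1_general {K : Type*} [Field K] (l m n k s t p d : ℕ) (hm : 0 < m) (hmn : m ≤ n)
    (hln : l ∣ n) (hs : s < l) (hmt : m = t * l + s) (hk : k = n / l) (hkp : k = p * (t + 1) + d)
    (hd : d ≤ t) :
    Nonempty (MinimalGradedFreeResolution (cyclePathIdeal K m l n)) ∧
    ∀ (F : MinimalGradedFreeResolution (cyclePathIdeal K m l n)) (i : ℕ),
      F.betti i n =
        if d = 0 ∧ i = 2 * p then t
        else if d ≠ 0 ∧ i = 2 * p + 1 then 1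
        else 0 := by
  have : NeZero n := ⟨by omega⟩
  have hn : n = k * l := by rw [hk, Nat.div_mul_cancel hln]
  have hk0 : 0 < k := Nat.pos_of_ne_zero (by rintro rfl; omega)
  rw [CyclePath.cyclePathIdeal_eq_monomialIdeal K hmn hln, ← hk]
  refine ⟨MinimalGradedFreeResolution.nonempty_of_isHomogeneous (isHomogeneous_monomialIdeal _)
    (monomialIdeal_le_span_range_X fun i => ?_), fun F i => ?_⟩
  · rw [Ne, ← Finsupp.degree_eq_zero_iff, degree_squarefreeExponent, CyclePath.vertices]
    simp [hm.ne']
  · have hcover (S : Finset (Fin k)) := CyclicCover.mem_covers.trans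
      (CyclePath.degree_sup_eq_iff_isCover hmn hn hs hmt S).symm
    rw [(CyclicCover.matching t k).betti_eq_card_critical hcover
      (fun A hA => CyclicCover.card_of_mem_critical hk0 hkp hd hA) F,
      CyclicCover.card_critical hk0 hkp hd]
    split_ifs <;> grind

theorem theorem5p1 {K : Type*} [Field K] (l m n k s t p d : ℕ)
    (hl : 1 ≤ l) (hm : 2 ≤ m) (hmn : m ≤ n) (hln : l ∣ n) (hlm : l ≤ m - 1) (hl2 : 2 * l ≤ n)
    (hs : s < l) (hmt : m = t * l + s) (ht : 2 ≤ t) (hk : k = n / l)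
    (hkp : k = p * (t + 1) + d) (hd : d ≤ t) :
    Nonempty (MinimalGradedFreeResolution (cyclePathIdeal K m l n)) ∧
    ∀ (F : MinimalGradedFreeResolution (cyclePathIdeal K m l n)) (i : ℕ),
      F.betti i n =
        if d = 0 ∧ i = 2 * p then t
        else if d ≠ 0 ∧ i = 2 * p + 1 then 1
        else 0 :=
  theorem5p1_general l m n k s t p d (by omega) hmn hln hs hmt hk hkp hd
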